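/- Let $p\ge 1$, let $k$ be a field, and let $R=k[x_{i,j}]$ and $S=k[w_{i,j},z_{i,j}]$ $(1\le i,j\le p)$ be polynomial rings, graded by $\mathbb{Z}^p\oplus\mathbb{Z}^p$ via $$\deg x_{i,j}=e_i\oplus e_j,\qquad \deg w_{i,j}=e_i\oplus 0,\qquad \deg z_{i,j}=0\oplus e_j .$$ Let $\varphi\colon R\to S$ be the $k$-algebra homomorphism with $\varphi(x_{i,j})=w_{i,j}z_{i,j}$. For an ideal $\mathfrak a$ of a polynomial ring $A$ in $n$ variables over $k$ put $\operatorname{codim}\mathfrak a=n-\dim(A/\mathfrak a)$ (with $\dim 0=-\infty$). For a finitely generated graded module $M$ with a finite graded free resolution $F_\bullet$, $F_i=\bigoplus_j A(-b_{i,j})$, let $\mathcal K(M)=\sum_i(-1)^i\sum_j \mathbf u^{b_{i,j}}$, a Laurent polynomial in the variables $\mathbf u=(t_1,\dots,t_p,s_1,\dots,s_p)$, be its K-polynomial, and let the multidegree polynomial $\mathcal C(M;\mathbf t,\mathbf s)\in\mathbb Z[\mathbf t,\mathbf s]$ be the sum of all terms of total degree $\operatorname{codim}M=n-\dim M$ in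 the power series $\mathcal K(M)(1-t_1,\dots,1-t_p,1-s_1,\dots,1-s_p)$. Let $I\subseteq R$ be a homogeneous ideal and let $J=\varphi(I)S$ be its standardization. Then: (i) $\operatorname{codim} I=\operatorname{codim} J$. (ii) The K-polynomials of $R/I$ and $S/J$ are well defined (finite graded free resolutions exist, and the result does not depend on the resolution), and $\mathcal C(R/I;\mathbf t,\mathbf s)=\mathcal C(S/J;\mathbf t,\mathbf s)$. (iii) If $R/I$ is a Cohen–Macaulay ring, then so is $S/J$. (iv) Let $>$ be a monomial order on $R$ and $>'$ a monomial order on $S$ that is compatible with $\varphi$, i.e. for monomials $f,g\in R$ with $f>g$ one has $\varphi(f)>'\varphi(g)$. Then $\operatorname{in}_{>'}(J)=\varphi(\operatorname{in}_{>}(I))S$. -/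

import Mathlib

open MvPolynomial

noncomputable section

namespace Multigraded

/-! ### Multigraded polynomial rings

A polynomial ring `k[x_a : a ∈ σ]` is graded by `ℤ^ι = (ι → ℤ)` through a weight function
`w : σ → (ι → ℤ)`, `w a` being the degree of `x_a`. -/

variable {k : Type*} [Field k] {σ : Type*} {ι : Type*}

/-- The ideal `I` is homogeneous for the grading defined by the weights `w`. -/
def IsHomogeneousIdeal (w : σ → (ι → ℤ)) (I : Ideal (MvPolynomial σ k)) : Prop := by
  classical
  letI := weightedGradedAlgebra k w
  exact I.IsHomogeneous (weightedHomogeneousSubmodule k w)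

/-- The grading of `k[x] / I` induced by the weights `w`: the piece of degree `a` consists of the
classes of the homogeneous polynomials of degree `a`. -/
def quotientGrading (w : σ → (ι → ℤ)) (I : Ideal (MvPolynomial σ k)) (a : ι → ℤ) :
    AddSubgroup (MvPolynomial σ k ⧸ I) :=
  (weightedHomogeneousSubmodule k w a).toAddSubgroup.map
    (Ideal.Quotient.mk I : MvPolynomial σ k →+ MvPolynomial σ k ⧸ I)

/-- The codimension `n - dim (k[x] / I)` of an ideal in a polynomial ring in `n` variables. With the
convention that the zero ring has dimension `-∞`, the unit ideal has codimension `∞`. -/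
def codim [Fintype σ] (I : Ideal (MvPolynomial σ k)) : ℕ∞ :=
  WithBot.recBotCoe (⊤ : ℕ∞) (fun d : ℕ∞ => (Fintype.card σ : ℕ∞) - d)
    (ringKrullDim (MvPolynomial σ k ⧸ I))

/-- A graded free resolution of finite length by free modules of finite rank
`0 → F_length → ⋯ → F_1 → F_0 → M → 0` of a module `M` over `k[x]` with graded pieces `ℳ`, where
`F_i = ⨁_j R(-b_{i,j})` is written as `R ^ rank i` with `b_{i,j} = shift i j` the degree of the
`j`-th basis vector; all maps are of degree zero. -/
structure GradedFreeResolution (k : Type*) [Field k] {σ ι : Type*} (w : σ → (ι → ℤ)) {M : Type*} [AddCommGroup M]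
    [Module (MvPolynomial σ k) M] (ℳ : (ι → ℤ) → AddSubgroup M) where
  length : ℕ
  rank : ℕ → ℕ
  rank_eq_zero : ∀ i, length < i → rank i = 0
  shift : ∀ i, Fin (rank i) → (ι → ℤ)
  /-- the differential `F_{i+1} → F_i` -/
  d : ∀ i, (Fin (rank (i + 1)) → MvPolynomial σ k) →ₗ[MvPolynomial σ k]
    (Fin (rank i) → MvPolynomial σ k)
  /-- the augmentation `F_0 → M` -/
  aug : (Fin (rank 0) → MvPolynomial σ k) →ₗ[MvPolynomial σ k] M
  d_homogeneous : ∀ i j l, IsWeightedHomogeneous w (d i (Pi.single j 1) l)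
    (shift (i + 1) j - shift i l)
  aug_homogeneous : ∀ j, aug (Pi.single j 1) ∈ ℳ (shift 0 j)
  exact_d : ∀ i, Function.Exact (d (i + 1)) (d i)
  exact_aug : Function.Exact (d 0) aug
  aug_surjective : Function.Surjective aug

/-- The alternating sum `∑_i (-1)^i [F_i]_t` in the Laurent polynomial ring `ℤ[t^{±1}]`, where
`[F_i]_t = ∑_j t^{b_{i,j}}`. -/
def GradedFreeResolution.laurent {w : σ → (ι → ℤ)} {M : Type*} [AddCommGroup M]
    [Module (MvPolynomial σ k) M] {ℳ : (ι → ℤ) → AddSubgroup M}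
    (F : GradedFreeResolution k w ℳ) : AddMonoidAlgebra ℤ (ι → ℤ) :=
  ∑ i ∈ Finset.range (F.length + 1),
    (-1) ^ i * ∑ j, AddMonoidAlgebra.single (F.shift i j) 1

/-- `K` is the K-polynomial of `M` computed from some finite graded free resolution. -/
def IsKPolynomial (k : Type*) [Field k] {σ ι : Type*} (w : σ → (ι → ℤ)) {M : Type*} [AddCommGroup M]
    [Module (MvPolynomial σ k) M] (ℳ : (ι → ℤ) → AddSubgroup M)
    (K : AddMonoidAlgebra ℤ (ι → ℤ)) : Prop :=
  ∃ F : GradedFreeResolution k w ℳ, F.laurent = K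

open Classical in
/-- The K-polynomial of `M`. -/
def kPolynomial (k : Type*) [Field k] {σ ι : Type*} (w : σ → (ι → ℤ)) {M : Type*} [AddCommGroup M]
    [Module (MvPolynomial σ k) M] (ℳ : (ι → ℤ) → AddSubgroup M) : AddMonoidAlgebra ℤ (ι → ℤ) :=
  if h : ∃ K, IsKPolynomial k w ℳ K then h.choose else 0

/-- The power series `1 - t_i`, a unit of `ℤ⟦t⟧`. -/
def oneSubVar (i : ι) : (MvPowerSeries ι ℤ)ˣ :=
  IsUnit.unit (a := (1 - MvPowerSeries.X i : MvPowerSeries ι ℤ))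
    (MvPowerSeries.isUnit_iff_constantCoeff.2 (by simp))

/-- The substitution `K(t) ↦ K(1 - t)` from Laurent polynomials to power series. -/
def substOneSub [Fintype ι] (K : AddMonoidAlgebra ℤ (ι → ℤ)) : MvPowerSeries ι ℤ :=
  K.coeff.sum fun b c => c • ((∏ i, oneSubVar i ^ b i : (MvPowerSeries ι ℤ)ˣ) : MvPowerSeries ι ℤ)

/-- The sum of all terms of total degree `c` of a power series. -/
def homogeneousPart [Fintype ι] [DecidableEq ι] (c : ℕ) (f : MvPowerSeries ι ℤ) :
    MvPolynomial ι ℤ :=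
  ∑ e ∈ Finset.finsuppAntidiag (Finset.univ : Finset ι) c, monomial e (MvPowerSeries.coeff e f)

/-- The multidegree polynomial `𝒞(M; t)`: the sum of all terms of total degree
`codim M = n - dim M` in `𝒦(M; 1 - t)`, where `dim M = dim (k[x] / Ann M)`. -/
def multidegree (k : Type*) [Field k] {σ ι : Type*} [Fintype σ] [Fintype ι] [DecidableEq ι]
    (w : σ → (ι → ℤ))
    {M : Type*} [AddCommGroup M] [Module (MvPolynomial σ k) M] (ℳ : (ι → ℤ) → AddSubgroup M) :
    MvPolynomial ι ℤ :=
  homogeneousPart (codim (Module.annihilator (MvPolynomial σ k) M)).toNat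
    (substOneSub (kPolynomial k w ℳ))

/-- The initial ideal of `I`, generated by the leading terms of all elements of `I`. -/
def initialIdeal (m : MonomialOrder σ) (I : Ideal (MvPolynomial σ k)) :
    Ideal (MvPolynomial σ k) :=
  Ideal.span (m.leadingTerm '' (I : Set (MvPolynomial σ k)))

/-! ### Cohen-Macaulay rings -/

/-- A Noetherian local ring is Cohen-Macaulay if its maximal ideal contains a regular sequence whose
length is the dimension of the ring, i.e. if its depth is equal to its dimension. -/
def IsCohenMacaulayLocal (A : Type*) [CommRing A] [IsLocalRing A] : Prop :=
  IsNoetherianRing A ∧ ∃ rs : List A, (∀ r ∈ rs, r ∈ IsLocalRing.maximalIdeal A) ∧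
    RingTheory.Sequence.IsRegular A rs ∧ (rs.length : WithBot ℕ∞) = ringKrullDim A

/-- A ring is Cohen-Macaulay if it is Noetherian and its localizations at all maximal ideals are
Cohen-Macaulay local rings. -/
def IsCohenMacaulay (A : Type*) [CommRing A] : Prop :=
  IsNoetherianRing A ∧ ∀ (𝔪 : Ideal A) [𝔪.IsMaximal], IsCohenMacaulayLocal (Localization.AtPrime 𝔪)

/-! ### The standardization map -/

/-- `R = k[x_{i,j}]`, `1 ≤ i, j ≤ p`. -/
abbrev RingR (p : ℕ) (k : Type*) [Field k] : Type _ := MvPolynomial (Fin p × Fin p) k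

/-- `S = k[w_{i,j}, z_{i,j}]`, where `Sum.inl (i, j)` is the index of `w_{i,j}` and `Sum.inr (i, j)`
is the index of `z_{i,j}`. -/
abbrev RingS (p : ℕ) (k : Type*) [Field k] : Type _ :=
  MvPolynomial ((Fin p × Fin p) ⊕ (Fin p × Fin p)) k

/-- `deg x_{i,j} = e_i ⊕ e_j`, where `ℤ^p ⊕ ℤ^p` is written as `Fin p ⊕ Fin p → ℤ`. -/
def degR (p : ℕ) : Fin p × Fin p → (Fin p ⊕ Fin p → ℤ) :=
  fun ij => Pi.single (Sum.inl ij.1) 1 + Pi.single (Sum.inr ij.2) 1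

/-- `deg w_{i,j} = e_i ⊕ 0` and `deg z_{i,j} = 0 ⊕ e_j`. -/
def degS (p : ℕ) : (Fin p × Fin p) ⊕ (Fin p × Fin p) → (Fin p ⊕ Fin p → ℤ) :=
  Sum.elim (fun ij => Pi.single (Sum.inl ij.1) 1) (fun ij => Pi.single (Sum.inr ij.2) 1)

/-- The `k`-algebra homomorphism `φ : R → S`, `x_{i,j} ↦ w_{i,j} z_{i,j}`. -/
def phi (p : ℕ) (k : Type*) [Field k] : RingR p k →ₐ[k] RingS p k :=
  aeval fun ij => X (Sum.inl ij) * X (Sum.inr ij)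

/-- The standardization `φ(I) S` of an ideal `I` of `R`. -/
def standardization {p : ℕ} (I : Ideal (RingR p k)) : Ideal (RingS p k) :=
  Ideal.map (phi p k) I

/-- The monomial order `m'` on `S` is compatible with `φ` and the monomial order `m` on `R`: for
monomials `f = x^a` and `g = x^b` of `R`, if `f > g`, then `φ(f) >' φ(g)`. -/
def IsCompatible {p : ℕ} (k : Type*) [Field k] (m : MonomialOrder (Fin p × Fin p))
    (m' : MonomialOrder ((Fin p × Fin p) ⊕ (Fin p × Fin p))) : Prop :=
  ∀ a b : (Fin p × Fin p) →₀ ℕ, m.toSyn b < m.toSyn a →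
    m'.toSyn (m'.degree (phi p k (monomial b 1))) < m'.toSyn (m'.degree (phi p k (monomial a 1)))

end Multigraded

end

open MvPolynomial

noncomputable section

namespace Multigraded

variable {k : Type*} [Field k] {σ : Type*}

/-! ### The doubling homomorphism and initial ideals -/

/-! Everything rests on two descriptions of `S` as an `R`-module through `φ`.

Geometrically, `φ` factors as the inclusion `R = k[w] → k[w, z]` followed by the substitution `w ↦
wz`, `z ↦ w + z` (`doubling_eq_comp`). The substitution replaces each pair of variables by its
elementary symmetric functions, so it is finite and free: one pair at a time, `1, w` is a basis.
Hence `φ` is flat, and `S/J` is a finite faithfully flat extension of `(R/I)[z]`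
(`exists_faithfullyFlat_isIntegral`). Such an extension preserves dimension and the Cohen–Macaulay
property, and adjoining the `p²` variables `z` raises the dimension by `p²` and keeps
Cohen–Macaulayness; this gives (i) and (iii).

For (ii), flat base change turns a graded resolution of `R/I` into one of `S/J` with the same ranks
and shifts, since `φ` preserves degrees. A finite resolution of `R/I` exists because minimal
syzygies must stop: projective dimensions are bounded (`finiteGlobalDimension_mvPolynomial`) and a
minimal graded cover of a projective module is injective (`cover_injective_of_projective`).
Uniqueness of the K-polynomial holds because the grading is positive: the alternating sum
determines, and is determined by, the Hilbert function (`hilbertPairing_laurent`,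
`eq_zero_of_hilbertPairing_eq_zero`).

Combinatorially, `S` is free over `R` on the monomials `u` divisible by no `w_a z_a`. Taking the
`u`-coordinate is `R`-linear, so it sends `J` into `I` (`coeffPart_mem`). The coordinate that
contains the leading monomial of `g ∈ J` therefore exhibits the leading term of `g` as a multiple of
the image of a leading term of `I`, which is the nontrivial inclusion in (iv). -/

/-- The homomorphism `k[x_a] → k[w_a, z_a]`, `x_a ↦ w_a z_a`. -/
def doubling (k : Type*) [Field k] (σ : Type*) : MvPolynomial σ k →ₐ[k] MvPolynomial (σ ⊕ σ) k :=
  aeval fun a => X (Sum.inl a) * X (Sum.inr a)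

/-- The exponent of `w^a z^a`. -/
def dbl (a : σ →₀ ℕ) : σ ⊕ σ →₀ ℕ := Finsupp.sumElim a a

@[simp] lemma dbl_inl (a : σ →₀ ℕ) (i : σ) : dbl a (Sum.inl i) = a i := by simp [dbl]

@[simp] lemma dbl_inr (a : σ →₀ ℕ) (i : σ) : dbl a (Sum.inr i) = a i := by simp [dbl]

lemma dbl_zero : dbl (0 : σ →₀ ℕ) = 0 := by
  ext (i | i) <;> simp

lemma dbl_single (i : σ) (n : ℕ) : dbl (Finsupp.single i n) =
    Finsupp.single (Sum.inl i) n + Finsupp.single (Sum.inr i) n := by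
  classical
  ext (j | j) <;> simp [Finsupp.single_apply]

lemma dbl_add (a b : σ →₀ ℕ) : dbl (a + b) = dbl a + dbl b := by
  ext (i | i) <;> simp

lemma dbl_injective : Function.Injective (dbl : (σ →₀ ℕ) → _) := fun a b h => by
  ext i
  simpa using DFunLike.congr_fun h (Sum.inl i)

lemma doubling_monomial (a : σ →₀ ℕ) (c : k) :
    doubling k σ (monomial a c) = monomial (dbl a) c := by
  induction a using Finsupp.induction_linear generalizing c with
  | zero =>
    rw [dbl_zero]
    simp [doubling]
  | add f g hf hg =>
    have : monomial (f + g) c = monomial f c * monomial g (1 : k) := by simp [monomial_mul]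
    rw [this, map_mul, hf, hg, monomial_mul, dbl_add, mul_one]
  | single i n =>
    rw [dbl_single, ← mul_one c, ← monomial_mul, ← C_mul_X_pow_eq_monomial, ← C_mul_X_pow_eq_monomial,
      ← C_mul_X_pow_eq_monomial]
    simp [doubling, mul_pow, mul_assoc]

open Classical in
/-- The `k`-linear map extracting from `g` the coefficient polynomial `f_u` of the monomial `u`
in the decomposition `g = ∑ φ(f_u) u`. -/
def coeffPart (u : σ ⊕ σ →₀ ℕ) : MvPolynomial (σ ⊕ σ) k →ₗ[k] MvPolynomial σ k :=
  (basisMonomials (σ ⊕ σ) k).constr k fun c =>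
    if h : ∃ a, c = u + dbl a then monomial h.choose 1 else 0

lemma coeff_coeffPart (u : σ ⊕ σ →₀ ℕ) (a : σ →₀ ℕ) (g : MvPolynomial (σ ⊕ σ) k) :
    coeff a (coeffPart u g) = coeff (u + dbl a) g := by
  classical
  suffices h : lcoeff k a ∘ₗ coeffPart u = lcoeff k (u + dbl a) from LinearMap.congr_fun h g
  refine (basisMonomials (σ ⊕ σ) k).ext fun c => ?_
  rw [LinearMap.comp_apply, coeffPart, Module.Basis.constr_basis]
  simp only [coe_basisMonomials, lcoeff_apply, coeff_monomial]
  split_ifs with h h' h'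
  · subst h'
    rw [coeff_monomial, if_pos]
    exact dbl_injective (add_left_cancel h.choose_spec.symm)
  · rw [coeff_monomial, if_neg]
    intro h2
    exact h' (h2 ▸ h.choose_spec)
  · exact (h ⟨a, h'⟩).elim
  · simp

/-- At every index one of the two exponents of `u` vanishes, so `u` contributes no factor `w_i z_i`,
and divisibility of `u · φ(x^a)` by `φ(x^b)` is divisibility of `x^a` by `x^b`. This makes the
`u`-coordinate linear over `R`. -/
lemma coeffPart_doubling_mul {u : σ ⊕ σ →₀ ℕ} (hu : ∀ i, u (Sum.inl i) = 0 ∨ u (Sum.inr i) = 0)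
    (f : MvPolynomial σ k) (g : MvPolynomial (σ ⊕ σ) k) :
    coeffPart u (doubling k σ f * g) = f * coeffPart u g := by
  classical
  induction f using MvPolynomial.induction_on' with
  | add p q hp hq => simp only [map_add, add_mul, hp, hq]
  | monomial b c =>
    ext a
    have key : dbl b ≤ u + dbl a ↔ b ≤ a := by
      constructor
      · intro h i
        rcases hu i with h0 | h0
        · simpa [h0] using h (Sum.inl i)
        · simpa [h0] using h (Sum.inr i)
      · rintro h (i | i)
        · simpa using (h i).trans (Nat.le_add_left _ _)
        · simpa using (h i).trans (Nat.le_add_left _ _)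
    rw [coeff_coeffPart, doubling_monomial, coeff_monomial_mul', coeff_monomial_mul']
    simp only [key]
    split_ifs with h
    · rw [coeff_coeffPart]
      congr 2
      ext (i | i)
      · have := h i
        simp; omega
      · have := h i
        simp; omega
    · rfl

lemma coeffPart_mem {u : σ ⊕ σ →₀ ℕ} (hu : ∀ i, u (Sum.inl i) = 0 ∨ u (Sum.inr i) = 0)
    {I : Ideal (MvPolynomial σ k)} {g : MvPolynomial (σ ⊕ σ) k}
    (hg : g ∈ I.map (doubling k σ)) : coeffPart u g ∈ I := by
  -- The coordinate map is only `R`-linear, so the induction over the span has to carry an arbitrary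
  -- multiplier from `S`.
  suffices h : ∀ s, coeffPart u (s * g) ∈ I by simpa using h 1
  refine Submodule.span_induction ?_ ?_ ?_ ?_ hg
  · rintro _ ⟨f, hf, rfl⟩ s
    have := coeffPart_doubling_mul hu f s
    rw [mul_comm] at this
    erw [this]
    exact I.mul_mem_right _ hf
  · simp
  · intro x y _ _ hx hy s
    rw [mul_add, map_add]
    exact I.add_mem (hx s) (hy s)
  · intro a x _ hx s
    rw [smul_eq_mul, ← mul_assoc]
    exact hx _

/-- Initial ideals commute with doubling the variables. -/
theorem initialIdeal_map_doubling (m : MonomialOrder σ) (m' : MonomialOrder (σ ⊕ σ))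
    (hm : ∀ a b : σ →₀ ℕ, m.toSyn b < m.toSyn a → m'.toSyn (dbl b) < m'.toSyn (dbl a))
    (I : Ideal (MvPolynomial σ k)) :
    initialIdeal m' (I.map (doubling k σ)) = (initialIdeal m I).map (doubling k σ) := by
  classical
  have hle : ∀ a b : σ →₀ ℕ, m'.toSyn (dbl b) ≤ m'.toSyn (dbl a) → m.toSyn b ≤ m.toSyn a :=
    fun a b h => not_lt.1 fun h' => (hm _ _ h').not_ge h
  have hle' : ∀ a b : σ →₀ ℕ, m.toSyn b ≤ m.toSyn a → m'.toSyn (dbl b) ≤ m'.toSyn (dbl a) := by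
    intro a b h
    rcases h.lt_or_eq with h | h
    · exact (hm _ _ h).le
    · rw [m.toSyn.injective h]
  apply le_antisymm
  · refine Ideal.span_le.2 ?_
    rintro _ ⟨g, hg, rfl⟩
    by_cases hg0 : g = 0
    · simp [hg0]
    set c := m'.degree g with hc
    -- `a₀` is the largest exponent with `φ(x^{a₀})` dividing the leading monomial of `g`; the
    -- cofactor `u` is then divisible by no `w_i z_i`.
    let a₀ : σ →₀ ℕ := Finsupp.zipWith min (min_self 0)
      (c.comapDomain Sum.inl Sum.inl_injective.injOn)
      (c.comapDomain Sum.inr Sum.inr_injective.injOn)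
    have ha₀ : ∀ i, a₀ i = min (c (Sum.inl i)) (c (Sum.inr i)) := fun i => by
      simp [a₀, Finsupp.zipWith_apply, Finsupp.comapDomain_apply]
    let u := c - dbl a₀
    have hu : ∀ i, u (Sum.inl i) = 0 ∨ u (Sum.inr i) = 0 := fun i => by
      simp only [u, Finsupp.tsub_apply, dbl_inl, dbl_inr, ha₀]
      omega
    have hcu : u + dbl a₀ = c := by
      ext (i | i)
      · simp [u, ha₀]
      · simp [u, ha₀]
    set f := coeffPart u g with hf
    have hfI : f ∈ I := coeffPart_mem hu hg
    have hfc : coeff a₀ f = m'.leadingCoeff g := by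
      rw [hf, coeff_coeffPart, hcu]; rfl
    have hne : coeff a₀ f ≠ 0 := by
      rw [hfc]; exact m'.leadingCoeff_ne_zero_iff.2 hg0
    -- Each exponent `a` of `f` comes from the exponent `u + dbl a` of `g`, which is at most `u +
    -- dbl a₀`; cancelling `u` and reflecting the order along `dbl` gives `a ≤ a₀`.
    have hdeg : m.degree f = a₀ := by
      apply m.toSyn.injective
      apply le_antisymm
      · refine m.degree_le_iff.2 fun a ha => hle _ _ ?_
        have hag : u + dbl a ∈ g.support := by
          rw [mem_support_iff, ← coeff_coeffPart]
          exact mem_support_iff.1 ha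
        have := m'.le_degree hag
        rw [← hc, ← hcu, map_add, map_add] at this
        exact le_of_add_le_add_left this
      · exact m.le_degree (mem_support_iff.2 hne)
    have : m'.leadingTerm g = monomial u 1 * doubling k σ (m.leadingTerm f) := by
      rw [MonomialOrder.leadingTerm, MonomialOrder.leadingTerm, MonomialOrder.leadingCoeff,
        MonomialOrder.leadingCoeff, doubling_monomial, hdeg, monomial_mul, hcu, one_mul, hfc]
      rfl
    rw [this]
    exact Ideal.mul_mem_left _ _ (Ideal.mem_map_of_mem _ (Ideal.subset_span ⟨f, hfI, rfl⟩))
  · refine Ideal.map_le_iff_le_comap.2 (Ideal.span_le.2 ?_)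
    rintro _ ⟨f, hf, rfl⟩
    refine Ideal.subset_span ⟨doubling k σ f, Ideal.mem_map_of_mem _ hf, ?_⟩
    by_cases hf0 : f = 0
    · simp [hf0]
    have h0 : ∀ a, coeff (dbl a) (doubling k σ f) = coeff a f := by
      intro a
      have h1 := coeffPart_doubling_mul (k := k) (u := (0 : σ ⊕ σ →₀ ℕ)) (by simp) f 1
      have h2 := coeff_coeffPart (k := k) (0 : σ ⊕ σ →₀ ℕ) a (doubling k σ f)
      have h3 : coeffPart (k := k) (0 : σ ⊕ σ →₀ ℕ) 1 = 1 := by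
        ext b
        rw [coeff_coeffPart, coeff_one, coeff_one, zero_add]
        have : (0 = dbl b) ↔ 0 = b :=
          ⟨fun h => by ext i; simpa using DFunLike.congr_fun h (Sum.inl i),
            fun h => by subst h; ext (i | i) <;> simp⟩
        simp [this]
      rw [mul_one, h3, mul_one] at h1
      rw [h1, zero_add] at h2
      exact h2.symm
    have hsupp : ∀ c ∈ (doubling k σ f).support, ∃ a ∈ f.support, c = dbl a := by
      intro c hc
      rw [f.as_sum, map_sum] at hc
      obtain ⟨a, ha, hca⟩ := Finset.mem_biUnion.1 (support_sum hc)
      rw [doubling_monomial] at hca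
      exact ⟨a, ha, by simpa using support_monomial_subset hca⟩
    have hdeg : m'.degree (doubling k σ f) = dbl (m.degree f) := by
      apply m'.toSyn.injective
      apply le_antisymm
      · refine m'.degree_le_iff.2 fun c hc => ?_
        obtain ⟨a, ha, rfl⟩ := hsupp c hc
        exact hle' _ _ (m.le_degree ha)
      · refine m'.le_degree (mem_support_iff.2 ?_)
        rw [h0]
        exact m.leadingCoeff_ne_zero_iff.2 hf0
    rw [MonomialOrder.leadingTerm, MonomialOrder.leadingTerm, MonomialOrder.leadingCoeff,
        MonomialOrder.leadingCoeff, doubling_monomial, hdeg, h0]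

end Multigraded

namespace Multigraded

/-! ### Permanence of the Cohen-Macaulay property -/

/-- By incomparability, contraction is strictly monotone on primes, so a chain below `P` contracts
to a chain of the same length below `p`. -/
lemma height_le_height_of_isIntegral {A B : Type*} [CommRing A] [CommRing B] [Algebra A B]
    [Algebra.IsIntegral A B] (p : Ideal A) [p.IsPrime] (P : Ideal B) [P.IsPrime] [P.LiesOver p] :
    P.height ≤ p.height := by
  have hmono : StrictMono (PrimeSpectrum.comap (algebraMap A B)) := fun x y hxy =>
    Ideal.IsIntegral.comap_lt_comap hxy
  have h := Order.height_le_height_apply_of_strictMono _ hmono ⟨P, inferInstance⟩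
  rw [← PrimeSpectrum.height_eq_orderHeight, ← PrimeSpectrum.height_eq_orderHeight] at h
  simpa [Ideal.over_def P p] using h

/-- A maximal ideal `P` contracts to a maximal ideal, and the local map of localizations is
faithfully flat, so a regular sequence downstairs stays regular. Its length is still the dimension:
going down gives one inequality of heights and incomparability the other. -/
lemma IsCohenMacaulay.of_flat_of_isIntegral {A B : Type*} [CommRing A] [CommRing B] [Algebra A B]
    [Algebra.IsIntegral A B] [Module.Flat A B] [IsNoetherianRing B] (hA : IsCohenMacaulay A) :
    IsCohenMacaulay B := by
  refine ⟨inferInstance, fun P hP => ?_⟩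
  have := hA.1
  have hpm : (P.under A).IsMaximal := Ideal.isMaximal_comap_of_isIntegral_of_isMaximal P
  obtain ⟨-, rs, hrs, hreg, hlen⟩ := hA.2 (P.under A)
  refine ⟨inferInstance, ?_⟩
  let := Localization.AtPrime.algebraOfLiesOver (P.under A) P
  have : IsLocalHom (algebraMap (Localization.AtPrime (P.under A)) (Localization.AtPrime P)) := by
    rw [RingHom.algebraMap_toAlgebra]
    exact Localization.isLocalHom_localRingHom (P.under A) P (algebraMap A B) Ideal.LiesOver.over
  have : Module.FaithfullyFlat (Localization.AtPrime (P.under A)) (Localization.AtPrime P) :=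
    Module.FaithfullyFlat.of_flat_of_isLocalHom
  refine ⟨rs.map (algebraMap _ _), ?_, hreg.of_faithfullyFlat, ?_⟩
  · intro r hr
    obtain ⟨s, hs, rfl⟩ := List.mem_map.1 hr
    exact map_nonunit (algebraMap _ _) s (hrs s hs)
  · rw [List.length_map, hlen, IsLocalization.AtPrime.ringKrullDim_eq_height (P.under A),
      IsLocalization.AtPrime.ringKrullDim_eq_height P]
    congr 1
    apply le_antisymm
    · rw [Ideal.height_eq_height_add_of_liesOver_of_hasGoingDown (P.under A) P]
      exact le_self_add
    · exact height_le_height_of_isIntegral (P.under A) P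

lemma IsCohenMacaulay.of_ringEquiv {A B : Type*} [CommRing A] [CommRing B] (e : A ≃+* B)
    (hA : IsCohenMacaulay A) : IsCohenMacaulay B := by
  algebraize [e.toRingHom]
  have := hA.1
  have : IsNoetherianRing B := isNoetherianRing_of_ringEquiv A e
  have : Module.Flat A B := RingHom.Flat.of_bijective e.bijective
  have : Algebra.IsIntegral A B := ⟨RingHom.isIntegral_of_surjective _ e.surjective⟩
  exact hA.of_flat_of_isIntegral

-- `L / fL` is the base change of `L` to `A[X] / (f)`, hence flat over it, and `A[X] / (f)` is free
-- over `A` because `f` is monic.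
open Polynomial Pointwise in
lemma flat_quotSMulTop_of_monic {A L : Type*} [CommRing A] [CommRing L] [Algebra A[X] L]
    [Algebra A L] [IsScalarTower A A[X] L] [Module.Flat A[X] L] {f : A[X]} (hf : f.Monic) :
    Module.Flat A (QuotSMulTop (algebraMap A[X] L f) L) := by
  have := hf.free_quotient
  let C' := A[X] ⧸ Ideal.span {f}
  have h1 : Module.Flat A (TensorProduct A[X] C' L) := Module.Flat.trans A C' _
  have h2 : Module.Flat A (TensorProduct A[X] L C') :=
    Module.Flat.of_linearEquiv ((TensorProduct.comm A[X] L C').restrictScalars A)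
  have h3 : Module.Flat A (QuotSMulTop f L) :=
    Module.Flat.of_linearEquiv ((QuotSMulTop.equivTensorQuot f L).restrictScalars A)
  have h4 : ((algebraMap A[X] L f • ⊤ : Submodule L L).restrictScalars A) =
      ((f • ⊤ : Submodule A[X] L).restrictScalars A) := by
    ext x
    simp [Submodule.mem_smul_pointwise_iff_exists, Algebra.smul_def]
  exact Module.Flat.of_linearEquiv ((Submodule.Quotient.restrictScalarsEquiv A _).symm.trans
    ((Submodule.quotEquivOfEq _ _ h4).trans (Submodule.Quotient.restrictScalarsEquiv A _)))

-- The Jacobson hypothesis makes the contraction of a maximal ideal `P` maximal and `A[X] / P`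
-- integral over `A`, so `P` contains a monic `f`. Putting `f` in front of a maximal regular
-- sequence of the localized base works: `L / fL` is flat over that base, so the old sequence is
-- still regular on it, and the height of `P` exceeds that of its contraction by one.
open Polynomial in
lemma IsCohenMacaulay.polynomial {A : Type*} [CommRing A] [IsJacobsonRing A]
    (hA : IsCohenMacaulay A) : IsCohenMacaulay A[X] := by
  have := hA.1
  refine ⟨inferInstance, fun P hP => ?_⟩
  have hpm : (P.under A).IsMaximal := Polynomial.isMaximal_comap_C_of_isJacobsonRing P
  obtain ⟨f, hf, hfP⟩ : ∃ f : A[X], f.Monic ∧ f ∈ P := by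
    obtain ⟨f, hf, h⟩ := Polynomial.quotient_mk_comp_C_isIntegral_of_isJacobsonRing P
      (Ideal.Quotient.mk P X)
    refine ⟨f, hf, ?_⟩
    rw [← Polynomial.hom_eval₂, Polynomial.eval₂_C_X] at h
    exact Ideal.Quotient.eq_zero_iff_mem.1 h
  obtain ⟨-, rs, hrs, hreg, hlen⟩ := hA.2 (P.under A)
  let := Localization.AtPrime.algebraOfLiesOver (P.under A) P
  have hloc : IsLocalHom (algebraMap (Localization.AtPrime (P.under A)) (Localization.AtPrime P)) := by
    rw [RingHom.algebraMap_toAlgebra]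
    exact Localization.isLocalHom_localRingHom (P.under A) P (algebraMap A A[X]) Ideal.LiesOver.over
  have : Module.Flat A[X] (Localization.AtPrime P) := IsLocalization.flat _ P.primeCompl
  set L := Localization.AtPrime P with hL
  have hmem : ∀ r ∈ algebraMap A[X] L f ::
      rs.map (algebraMap (Localization.AtPrime (P.under A)) L), r ∈ IsLocalRing.maximalIdeal L := by
    intro r hr
    rcases List.mem_cons.1 hr with rfl | hr
    · exact (IsLocalization.AtPrime.to_map_mem_maximal_iff L P f).2 hfP
    · obtain ⟨s, hs, rfl⟩ := List.mem_map.1 hr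
      exact map_nonunit (algebraMap _ _) s (hrs s hs)
  refine ⟨inferInstance, _, hmem, ?_, ?_⟩
  · rw [IsLocalRing.isRegular_iff_isWeaklyRegular_of_subset_maximalIdeal hmem,
      RingTheory.Sequence.isWeaklyRegular_cons_iff]
    constructor
    · have : IsSMulRegular A[X] f := hf.isRegular.left.isSMulRegular
      exact this.of_flat
    · rw [RingTheory.Sequence.isWeaklyRegular_map_algebraMap_iff]
      have h1 : Module.Flat A (QuotSMulTop (algebraMap A[X] L f) L) := flat_quotSMulTop_of_monic hf
      have h2 : Module.Flat (Localization.AtPrime (P.under A))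
          (QuotSMulTop (algebraMap A[X] L f) L) := by
        rwa [Module.flat_iff_of_isLocalization _ (P.under A).primeCompl]
      exact ((TensorProduct.rid _ _).isWeaklyRegular_congr _).1
        (hreg.1.isWeaklyRegular_lTensor (M₂ := QuotSMulTop (algebraMap A[X] L f) L))
  · rw [List.length_cons, List.length_map, Nat.cast_add, hlen,
      IsLocalization.AtPrime.ringKrullDim_eq_height (P.under A),
      IsLocalization.AtPrime.ringKrullDim_eq_height P, Polynomial.height_eq_height_add_one (P.under A) P]
    rfl

lemma IsCohenMacaulay.mvPolynomial {A σ : Type*} [CommRing A] [IsJacobsonRing A] [Finite σ]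
    (hA : IsCohenMacaulay A) : IsCohenMacaulay (MvPolynomial σ A) := by
  induction σ using Finite.induction_empty_option with
  | of_equiv e h => exact h.of_ringEquiv (renameEquiv A e).toRingEquiv
  | h_empty => exact hA.of_ringEquiv (isEmptyRingEquiv A PEmpty).symm
  | h_option h => exact h.polynomial.of_ringEquiv (optionEquivLeft A _).symm.toRingEquiv

end Multigraded

namespace Multigraded

/-! ### Finite faithfully flat extensions -/

/-- Faithful flatness lifts every prime of `A`, and going down shows that the height does not drop;
integrality bounds the other direction by incomparability. -/
lemma ringKrullDim_eq_of_faithfullyFlat_of_isIntegral {A B : Type*} [CommRing A] [CommRing B]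
    [IsNoetherianRing A] [IsNoetherianRing B] {f : A →+* B} (hf : f.FaithfullyFlat) (hi : f.IsIntegral) :
    ringKrullDim A = ringKrullDim B := by
  algebraize [f]
  have : Module.Flat A B := hf.flat
  have : Algebra.IsIntegral A B := ⟨hi⟩
  have hsurj := (RingHom.FaithfullyFlat.iff_flat_and_comap_surjective.1 hf).2
  apply le_antisymm
  · refine (ringKrullDim_le_iff_height_le _).2 fun p hp => ?_
    obtain ⟨P, hP⟩ := hsurj ⟨p, hp⟩
    have : P.asIdeal.LiesOver p := ⟨(congrArg PrimeSpectrum.asIdeal hP).symm⟩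
    have h := Ideal.height_eq_height_add_of_liesOver_of_hasGoingDown p P.asIdeal
    refine le_trans ?_ (Ideal.height_le_ringKrullDim_of_isPrime (I := P.asIdeal))
    rw [h]
    exact_mod_cast le_self_add
  · exact Order.krullDim_le_of_strictMono (PrimeSpectrum.comap (algebraMap A B)) fun x y hxy =>
      Ideal.IsIntegral.comap_lt_comap hxy

lemma faithfullyFlat_quotientMap {A B : Type*} [CommRing A] [CommRing B] {f : A →+* B}
    (hf : f.FaithfullyFlat) (I : Ideal A) :
    (Ideal.quotientMap (I.map f) f Ideal.le_comap_map).FaithfullyFlat := by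
  algebraize [f]
  have h : Module.FaithfullyFlat (A ⧸ I) (B ⧸ I.map (algebraMap A B)) :=
    Module.FaithfullyFlat.of_linearEquiv _ _
      (Algebra.TensorProduct.quotIdealMapEquivQuotTensor B I).toLinearEquiv
  exact RingHom.faithfullyFlat_algebraMap_iff.2 h

/-- A ring homomorphism `A → B` for which `1, t` is a basis of `B` over `A`. -/
lemma faithfullyFlat_of_bijective {A B : Type*} [CommRing A] [CommRing B] [Nontrivial A] (f : A →+* B) (t : B)
    (h : Function.Bijective fun a : A × A => f a.1 + f a.2 * t) : f.FaithfullyFlat := by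
  algebraize [f]
  let g : A × A →ₗ[A] B :=
    LinearMap.coprod (Algebra.linearMap A B) (LinearMap.mulRight A t ∘ₗ Algebra.linearMap A B)
  exact Module.FaithfullyFlat.of_linearEquiv _ _ (LinearEquiv.ofBijective g h).symm

/-! ### The substitution by elementary symmetric functions in pairs of variables. -/

variable {k : Type*} [Field k] {σ : Type*}

open Classical in
/-- The substitution `w_a ↦ w_a z_a`, `z_a ↦ w_a + z_a` for all `a ∈ T`. -/
def esymmSubst (k : Type*) [Field k] (T : Finset σ) :
    MvPolynomial (σ ⊕ σ) k →ₐ[k] MvPolynomial (σ ⊕ σ) k :=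
  aeval (Sum.elim
    (fun a => if a ∈ T then X (Sum.inl a) * X (Sum.inr a) else X (Sum.inl a))
    (fun a => if a ∈ T then X (Sum.inl a) + X (Sum.inr a) else X (Sum.inr a)))

lemma esymmSubst_X_of_ne {c : σ} {x : σ ⊕ σ} (h₁ : x ≠ Sum.inl c) (h₂ : x ≠ Sum.inr c) :
    esymmSubst k {c} (X x) = X x := by
  rcases x with a | a
  · have : a ≠ c := fun h => h₁ (h ▸ rfl)
    simp [esymmSubst, this]
  · have : a ≠ c := fun h => h₂ (h ▸ rfl)
    simp [esymmSubst, this]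

lemma esymmSubst_inl (c : σ) :
    esymmSubst k {c} (X (Sum.inl c)) = X (Sum.inl c) * X (Sum.inr c) := by simp [esymmSubst]

lemma esymmSubst_inr (c : σ) :
    esymmSubst k {c} (X (Sum.inr c)) = X (Sum.inl c) + X (Sum.inr c) := by simp [esymmSubst]

/-- The variable `w_c` is a root of `T² - (w_c + z_c) T + w_c z_c`, whose coefficients lie in the
image, and `z_c` is `(w_c + z_c) - w_c`. -/
lemma esymmSubst_singleton_isIntegral (c : σ) :
    (esymmSubst k {c} : MvPolynomial (σ ⊕ σ) k →+* MvPolynomial (σ ⊕ σ) k).IsIntegral := by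
  set θ := (esymmSubst k {c} : MvPolynomial (σ ⊕ σ) k →+* MvPolynomial (σ ⊕ σ) k) with hθ
  have hl : θ.IsIntegralElem (X (Sum.inl c)) := by
    refine ⟨Polynomial.X ^ 2 - Polynomial.C (X (Sum.inr c)) * Polynomial.X +
      Polynomial.C (X (Sum.inl c)), by monicity!, ?_⟩
    simp [hθ, esymmSubst_inl, esymmSubst_inr]
    ring
  have hr : θ.IsIntegralElem (X (Sum.inr c)) := by
    have : X (Sum.inr c) = θ (X (Sum.inr c)) - X (Sum.inl c) := by
      simp [hθ, esymmSubst_inr]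
    rw [this]
    exact (θ.isIntegralElem_map).sub _ hl
  intro g
  induction g using MvPolynomial.induction_on with
  | C a =>
    have : C a = θ (C a) := by simp [hθ, ← algebraMap_eq]
    rw [this]
    exact θ.isIntegralElem_map
  | add p q hp hq => exact hp.add _ hq
  | mul_X p x hp =>
    refine hp.mul _ ?_
    by_cases h₁ : x = Sum.inl c
    · rwa [h₁]
    by_cases h₂ : x = Sum.inr c
    · rwa [h₂]
    have : X x = θ (X x) := (esymmSubst_X_of_ne h₁ h₂).symm
    rw [this]
    exact θ.isIntegralElem_map

/-- `A` is integral over `A / ker θ`, so the quotient has dimension at least `dim A`; but in a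
domain of finite dimension, a nonzero element of the kernel would force the dimension of the
quotient to drop. -/
lemma injective_of_isIntegral_endomorphism {A : Type*} [CommRing A] [IsDomain A]
    {n : ℕ} (hn : ringKrullDim A = n) (θ : A →+* A) (h : θ.IsIntegral) : Function.Injective θ := by
  rw [RingHom.injective_iff_ker_eq_bot]
  by_contra hne
  obtain ⟨x, hx, hx0⟩ := Submodule.exists_mem_ne_zero_of_ne_bot hne
  have h1 : ringKrullDim A ≤ ringKrullDim (A ⧸ RingHom.ker θ) := by
    have hi : (RingHom.kerLift θ).IsIntegral := by
      refine RingHom.IsIntegral.tower_top (Ideal.Quotient.mk (RingHom.ker θ)) _ ?_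
      convert h
      exact RingHom.ext fun _ => rfl
    algebraize [RingHom.kerLift θ]
    have : Algebra.IsIntegral (A ⧸ RingHom.ker θ) A := ⟨hi⟩
    exact Order.krullDim_le_of_strictMono
      (PrimeSpectrum.comap (algebraMap (A ⧸ RingHom.ker θ) A)) fun x y hxy =>
      Ideal.IsIntegral.comap_lt_comap hxy
  have h2 := ringKrullDim_quotient_succ_le_of_nonZeroDivisor (mem_nonZeroDivisors_of_ne_zero hx0)
  have h3 : ringKrullDim (A ⧸ RingHom.ker θ) ≤ ringKrullDim (A ⧸ Ideal.span {x}) :=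
    ringKrullDim_le_of_surjective (Ideal.Quotient.factor ((Ideal.span_singleton_le_iff_mem _).2 hx))
      (Ideal.Quotient.factor_surjective _)
  have h4 : ringKrullDim A + 1 ≤ ringKrullDim A := (add_le_add_left (h1.trans h3) 1).trans h2
  rw [hn] at h4
  norm_cast at h4
  omega

lemma esymmSubst_singleton_faithfullyFlat [Finite σ] (c : σ) :
    (esymmSubst k {c} : MvPolynomial (σ ⊕ σ) k →+* MvPolynomial (σ ⊕ σ) k).FaithfullyFlat := by
  classical
  set θ := (esymmSubst k {c} : MvPolynomial (σ ⊕ σ) k →+* MvPolynomial (σ ⊕ σ) k) with hθ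
  have hθl : θ (X (Sum.inl c)) = X (Sum.inl c) * X (Sum.inr c) := esymmSubst_inl c
  have hθr : θ (X (Sum.inr c)) = X (Sum.inl c) + X (Sum.inr c) := esymmSubst_inr c
  have hinj : Function.Injective θ := by
    have hdim : ringKrullDim (MvPolynomial (σ ⊕ σ) k) = (Nat.card (σ ⊕ σ) : ℕ) := by simp
    exact injective_of_isIntegral_endomorphism hdim θ (esymmSubst_singleton_isIntegral c)
  refine faithfullyFlat_of_bijective θ (X (Sum.inl c)) ⟨?_, ?_⟩
  -- The image of `θ` consists of polynomials symmetric in `w_c` and `z_c`. Applying the swap to a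
  -- relation between `1` and `w_c` and subtracting leaves `θ f₁ · (w_c - z_c) = 0`.
  · let s := rename (R := k) (Equiv.swap (Sum.inl c : σ ⊕ σ) (Sum.inr c))
    have hs : ∀ f, s (θ f) = θ f := by
      intro f
      suffices h : s.comp (esymmSubst k {c}) = esymmSubst k {c} from DFunLike.congr_fun h f
      ext x : 1
      rw [AlgHom.comp_apply]
      by_cases h₁ : x = Sum.inl c
      · subst h₁
        simp [s, esymmSubst_inl, mul_comm]
      by_cases h₂ : x = Sum.inr c
      · subst h₂
        simp [s, esymmSubst_inr, add_comm]
      rw [esymmSubst_X_of_ne h₁ h₂, rename_X, Equiv.swap_apply_of_ne_of_ne h₁ h₂]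
    have key : ∀ f₀ f₁, θ f₀ + θ f₁ * X (Sum.inl c) = 0 → f₀ = 0 ∧ f₁ = 0 := by
      intro f₀ f₁ h
      have h' := congrArg s h
      rw [map_add, map_mul, hs, hs, map_zero] at h'
      have hX : s (X (Sum.inl c)) = X (Sum.inr c) := by simp [s]
      rw [hX] at h'
      have h2 : θ f₁ * (X (Sum.inl c) - X (Sum.inr c)) = 0 := by linear_combination h - h'
      have hne : (X (Sum.inl c) - X (Sum.inr c) : MvPolynomial (σ ⊕ σ) k) ≠ 0 := by
        rw [sub_ne_zero]
        exact fun h => Sum.inl_ne_inr (X_injective h)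
      have h3 : θ f₁ = 0 := (mul_eq_zero.1 h2).resolve_right hne
      rw [h3, zero_mul, add_zero] at h
      exact ⟨(map_eq_zero_iff θ hinj).1 h, (map_eq_zero_iff θ hinj).1 h3⟩
    rintro ⟨a, b⟩ ⟨a', b'⟩ h
    have := key (a - a') (b - b') (by
      simp only at h
      rw [map_sub, map_sub]
      linear_combination h)
    rw [sub_eq_zero, sub_eq_zero] at this
    exact Prod.ext this.1 this.2
  · intro g
    induction g using MvPolynomial.induction_on with
    | C a => exact ⟨(C a, 0), by simp [hθ, ← algebraMap_eq]⟩
    | add p q hp hq =>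
      obtain ⟨⟨a, b⟩, rfl⟩ := hp
      obtain ⟨⟨a', b'⟩, rfl⟩ := hq
      refine ⟨(a + a', b + b'), ?_⟩
      simp only [map_add]
      ring
    | mul_X p x hp =>
      obtain ⟨⟨a, b⟩, rfl⟩ := hp
      by_cases h₁ : x = Sum.inl c
      · subst h₁
        -- From `w_c² = θ(z_c) w_c - θ(w_c)`.
        refine ⟨(-(b * X (Sum.inl c)), a + b * X (Sum.inr c)), ?_⟩
        simp only [map_add, map_mul, map_neg, hθl, hθr]
        ring
      by_cases h₂ : x = Sum.inr c
      · subst h₂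
        -- From `z_c = θ(z_c) - w_c` and `w_c z_c = θ(w_c)`.
        refine ⟨(a * X (Sum.inr c) + b * X (Sum.inl c), -a), ?_⟩
        simp only [map_add, map_mul, map_neg, hθl, hθr]
        ring
      · have : θ (X x) = X x := esymmSubst_X_of_ne h₁ h₂
        refine ⟨(a * X x, b * X x), ?_⟩
        simp only [map_mul, this]
        ring

lemma esymmSubst_insert [DecidableEq σ] (c : σ) (T : Finset σ) (hc : c ∉ T) :
    esymmSubst k (insert c T) = (esymmSubst k {c}).comp (esymmSubst k T) := by
  ext x : 1
  rw [AlgHom.comp_apply]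
  rcases x with a | a <;> by_cases h : a ∈ T
  all_goals
    by_cases hac : a = c
    · subst hac
      simp_all [esymmSubst]
    · simp [esymmSubst, h, hac]

lemma esymmSubst_faithfullyFlat_and_isIntegral [Finite σ] (T : Finset σ) :
    (esymmSubst k T : MvPolynomial (σ ⊕ σ) k →+* MvPolynomial (σ ⊕ σ) k).FaithfullyFlat ∧
      (esymmSubst k T : MvPolynomial (σ ⊕ σ) k →+* MvPolynomial (σ ⊕ σ) k).IsIntegral := by
  classical
  induction T using Finset.induction_on with
  | empty =>
    have : esymmSubst k (∅ : Finset σ) = AlgHom.id k _ := by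
      ext (a | a) : 1 <;> simp [esymmSubst]
    have h' : ((AlgHom.id k (MvPolynomial (σ ⊕ σ) k) : _ →ₐ[k] _) :
        MvPolynomial (σ ⊕ σ) k →+* MvPolynomial (σ ⊕ σ) k) = RingHom.id _ := rfl
    rw [this, h']
    exact ⟨RingHom.FaithfullyFlat.of_bijective (f := RingHom.id _) Function.bijective_id,
      RingHom.isIntegral_of_surjective _ Function.surjective_id⟩
  | insert c T hc ih =>
    rw [esymmSubst_insert c T hc, AlgHom.comp_toRingHom]
    exact ⟨RingHom.FaithfullyFlat.stableUnderComposition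
      (f := (esymmSubst k T : MvPolynomial (σ ⊕ σ) k →+* MvPolynomial (σ ⊕ σ) k))
      (g := (esymmSubst k {c} : MvPolynomial (σ ⊕ σ) k →+* MvPolynomial (σ ⊕ σ) k)) ih.1
      (esymmSubst_singleton_faithfullyFlat c),
      RingHom.IsIntegral.trans _ _ ih.2 (esymmSubst_singleton_isIntegral c)⟩

/-- This splits `φ` into a polynomial extension and a finite free map, so flatness, dimension and
depth can be followed through each factor separately. -/
lemma doubling_eq_comp [Fintype σ] :
    doubling k σ = (esymmSubst k Finset.univ).comp (rename Sum.inl) := by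
  ext x : 1
  simp [doubling, esymmSubst]

/-- The isomorphism `k[w, z] ≃ k[w][z]`. -/
def sumCommRingEquiv (k : Type*) [Field k] (σ : Type*) :
    MvPolynomial (σ ⊕ σ) k ≃+* MvPolynomial σ (MvPolynomial σ k) :=
  ((renameEquiv k (Equiv.sumComm σ σ)).trans (sumAlgEquiv k σ σ)).toRingEquiv

lemma sumCommRingEquiv_rename_inl (f : MvPolynomial σ k) :
    sumCommRingEquiv k σ (rename Sum.inl f) = C f := by
  have h : ((sumCommRingEquiv k σ : MvPolynomial (σ ⊕ σ) k →+* MvPolynomial σ (MvPolynomial σ k)).comp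
      (rename Sum.inl : MvPolynomial σ k →ₐ[k] _).toRingHom) = C := by
    refine MvPolynomial.ringHom_ext (fun r => ?_) fun i => ?_
    · simp [sumCommRingEquiv]
    · simp [sumCommRingEquiv]
  exact RingHom.congr_fun h f

/-- The isomorphism `k[w, z] / I k[w, z] ≃ (k[w] / I)[z]`. -/
def quotientMapRenameEquiv (I : Ideal (MvPolynomial σ k)) :
    MvPolynomial (σ ⊕ σ) k ⧸ I.map (rename Sum.inl : MvPolynomial σ k →ₐ[k] _) ≃+*
      MvPolynomial σ (MvPolynomial σ k ⧸ I) :=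
  (Ideal.quotientEquiv _ (I.map C) (sumCommRingEquiv k σ) (by
    rw [← Ideal.map_coe (rename Sum.inl : MvPolynomial σ k →ₐ[k] MvPolynomial (σ ⊕ σ) k),
      Ideal.map_map]
    congr 1
    exact (RingHom.ext sumCommRingEquiv_rename_inl).symm)).trans
    (quotientEquivQuotientMvPolynomial (σ := σ) I).symm.toRingEquiv

lemma rename_inl_flat :
    ((rename Sum.inl : MvPolynomial σ k →ₐ[k] MvPolynomial (σ ⊕ σ) k) :
      MvPolynomial σ k →+* MvPolynomial (σ ⊕ σ) k).Flat := by
  have h1 : (C : MvPolynomial σ k →+* MvPolynomial σ (MvPolynomial σ k)).Flat :=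
    RingHom.flat_algebraMap_iff.2 inferInstance
  have h2 : ((sumCommRingEquiv k σ).symm :
      MvPolynomial σ (MvPolynomial σ k) →+* MvPolynomial (σ ⊕ σ) k).Flat :=
    RingHom.Flat.of_bijective (sumCommRingEquiv k σ).symm.bijective
  convert h1.comp h2
  refine RingHom.ext fun f => ?_
  rw [RingHom.comp_apply, RingHom.coe_coe, RingHom.coe_coe, ← sumCommRingEquiv_rename_inl,
    RingEquiv.symm_apply_apply]

lemma doubling_flat [Finite σ] :
    (doubling k σ : MvPolynomial σ k →+* MvPolynomial (σ ⊕ σ) k).Flat := by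
  have := Fintype.ofFinite σ
  rw [doubling_eq_comp, AlgHom.comp_toRingHom]
  exact rename_inl_flat.comp (esymmSubst_faithfullyFlat_and_isIntegral Finset.univ).1.flat

/-- `k[w, z] / φ(I)` is a finite faithfully flat extension of a polynomial ring over `k[x] / I`. -/
lemma exists_faithfullyFlat_isIntegral [Finite σ] (I : Ideal (MvPolynomial σ k)) :
    ∃ f : MvPolynomial σ (MvPolynomial σ k ⧸ I) →+*
      MvPolynomial (σ ⊕ σ) k ⧸ I.map (doubling k σ),
      RingHom.FaithfullyFlat (R := MvPolynomial σ (MvPolynomial σ k ⧸ I))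
        (S := MvPolynomial (σ ⊕ σ) k ⧸ I.map (doubling k σ)) f ∧
      RingHom.IsIntegral (R := MvPolynomial σ (MvPolynomial σ k ⧸ I)) (A := MvPolynomial (σ ⊕ σ) k ⧸ I.map (doubling k σ)) f := by
  have := Fintype.ofFinite σ
  obtain ⟨h1, h2⟩ := esymmSubst_faithfullyFlat_and_isIntegral (k := k) (Finset.univ : Finset σ)
  set ψ := (esymmSubst k (Finset.univ : Finset σ) : MvPolynomial (σ ⊕ σ) k →+* MvPolynomial (σ ⊕ σ) k) with hψ
  set 𝔞 := I.map (rename Sum.inl : MvPolynomial σ k →ₐ[k] MvPolynomial (σ ⊕ σ) k) with h𝔞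
  have hmap : I.map (doubling k σ) = 𝔞.map ψ := by
    rw [h𝔞, ← Ideal.map_coe (rename Sum.inl : MvPolynomial σ k →ₐ[k] MvPolynomial (σ ⊕ σ) k),
      Ideal.map_map, doubling_eq_comp, ← Ideal.map_coe, AlgHom.comp_toRingHom]
  rw [hmap]
  have h3 := faithfullyFlat_quotientMap h1 𝔞
  have h4 : (Ideal.quotientMap (𝔞.map ψ) ψ Ideal.le_comap_map).IsIntegral := by
    refine RingHom.IsIntegral.tower_top (Ideal.Quotient.mk 𝔞) _ ?_
    rw [Ideal.quotientMap_comp_mk]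
    exact h2.trans _ _ (RingHom.isIntegral_of_surjective _ Ideal.Quotient.mk_surjective)
  refine ⟨(Ideal.quotientMap (𝔞.map ψ) ψ Ideal.le_comap_map).comp
    (quotientMapRenameEquiv I).symm.toRingHom,
    RingHom.FaithfullyFlat.stableUnderComposition _ _
      (RingHom.FaithfullyFlat.of_bijective (quotientMapRenameEquiv I).symm.bijective) h3,
    (RingHom.isIntegral_of_surjective _ (quotientMapRenameEquiv I).symm.surjective).trans _ _ h4⟩

/-! ### Dimension, codimension and Cohen–Macaulayness under doubling. -/

theorem ringKrullDim_quotient_map_doubling [Finite σ] (I : Ideal (MvPolynomial σ k)) :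
    ringKrullDim (MvPolynomial (σ ⊕ σ) k ⧸ I.map (doubling k σ)) =
      ringKrullDim (MvPolynomial σ k ⧸ I) + Nat.card σ := by
  obtain ⟨f, h1, h2⟩ := exists_faithfullyFlat_isIntegral I
  rw [← ringKrullDim_eq_of_faithfullyFlat_of_isIntegral h1 h2,
    MvPolynomial.ringKrullDim_of_isNoetherianRing]

theorem codim_map_doubling [Fintype σ] (I : Ideal (MvPolynomial σ k)) :
    codim (I.map (doubling k σ)) = codim I := by
  have h := ringKrullDim_quotient_map_doubling I
  have hle : ringKrullDim (MvPolynomial σ k ⧸ I) ≤ (Fintype.card σ : ℕ) := by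
    refine (ringKrullDim_quotient_le I).trans_eq ?_
    simp
  unfold codim
  rw [h]
  generalize ringKrullDim (MvPolynomial σ k ⧸ I) = d at hle
  induction d with
  -- The unit ideal: both quotients have dimension `-∞`, so both codimensions are `∞`.
  | bot => rfl
  | coe d =>
    have hle' : d ≤ (Fintype.card σ : ℕ) := by exact_mod_cast hle
    lift d to ℕ using ne_top_of_le_ne_top (ENat.natCast_ne_top _) hle'
    have : ((d : ℕ∞) : WithBot ℕ∞) + (Nat.card σ : WithBot ℕ∞) = ((d + Fintype.card σ : ℕ) : ℕ∞) := by
      simp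
    rw [this]
    simp only [WithBot.recBotCoe_coe, Fintype.card_sum]
    rw [← ENat.natCast_sub, ← ENat.natCast_sub]
    congr 1
    omega

theorem isCohenMacaulay_quotient_map_doubling [Finite σ] (I : Ideal (MvPolynomial σ k))
    (h : IsCohenMacaulay (MvPolynomial σ k ⧸ I)) :
    IsCohenMacaulay (MvPolynomial (σ ⊕ σ) k ⧸ I.map (doubling k σ)) := by
  obtain ⟨f, h1, h2⟩ := exists_faithfullyFlat_isIntegral I
  have : IsJacobsonRing (MvPolynomial σ k ⧸ I) := inferInstance
  algebraize [f]
  have : Module.Flat (MvPolynomial σ (MvPolynomial σ k ⧸ I))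
    (MvPolynomial (σ ⊕ σ) k ⧸ I.map (doubling k σ)) := h1.flat
  have : Algebra.IsIntegral (MvPolynomial σ (MvPolynomial σ k ⧸ I))
    (MvPolynomial (σ ⊕ σ) k ⧸ I.map (doubling k σ)) := ⟨h2⟩
  exact (h.mvPolynomial (σ := σ)).of_flat_of_isIntegral

end Multigraded

namespace Multigraded

/-! ### Hilbert's syzygy theorem -/

section Syzygy

open CategoryTheory TensorProduct

universe u

lemma shortExact_of_exact {A : Type u} [CommRing A] {M N P : Type u} [AddCommGroup M]
    [AddCommGroup N] [AddCommGroup P] [Module A M] [Module A N] [Module A P] (f : M →ₗ[A] N)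
    (g : N →ₗ[A] P) (hf : Function.Injective f) (hfg : Function.Exact f g)
    (hg : Function.Surjective g) :
    (ShortComplex.mk (ModuleCat.ofHom f) (ModuleCat.ofHom g)
      (by rw [← ModuleCat.ofHom_comp, hfg.linearMap_comp_eq_zero]; rfl)).ShortExact where
  exact := by
    rw [ShortComplex.ShortExact.moduleCat_exact_iff_function_exact]
    exact hfg
  mono_f := (ModuleCat.mono_iff_injective _).2 hf
  epi_g := (ModuleCat.epi_iff_surjective _).2 hg

/-- Dimension shifting: a presentation by a projective module stays short exact after flat base
change, and projectives stay projective. -/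
lemma hasProjectiveDimensionLT_tensorProduct {A : Type u} [CommRing A] (B : Type u) [CommRing B]
    [Algebra A B] [Module.Flat A B] (n : ℕ) (M : Type u) [AddCommGroup M] [Module A M]
    (h : HasProjectiveDimensionLT (ModuleCat.of A M) (n + 1)) :
    HasProjectiveDimensionLT (ModuleCat.of B (B ⊗[A] M)) (n + 1) := by
  induction n generalizing M with
  | zero =>
    rw [zero_add, ← projective_iff_hasProjectiveDimensionLT_one, ← IsProjective.iff_projective] at h ⊢
    infer_instance
  | succ n ih =>
    let S := (ModuleCat.of A M).projectiveShortComplex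
    have hS := (ModuleCat.of A M).shortExact_projectiveShortComplex
    have h1 := (hS.hasProjectiveDimensionLT_X₃_iff n inferInstance).1 h
    have h2 := ih _ h1
    have hf := hS.moduleCat_injective_f
    have hg := hS.moduleCat_surjective_g
    have hfg := (ShortComplex.ShortExact.moduleCat_exact_iff_function_exact _).1 hS.exact
    have h3 := shortExact_of_exact (S.f.hom.baseChange B) (S.g.hom.baseChange B)
      (Module.Flat.lTensor_preserves_injective_linearMap _ hf)
      (lTensor_exact B hfg hg) (LinearMap.lTensor_surjective B hg)
    have h4 : Module.Projective A S.X₂ := (IsProjective.iff_projective _).2 inferInstance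
    exact (h3.hasProjectiveDimensionLT_X₃_iff n
      ((IsProjective.iff_projective _).1 (inferInstanceAs (Module.Projective B (B ⊗[A] S.X₂))))).2 h2

-- The characteristic sequence of the endomorphism `X` of `M`: the first map is `X ⊗ 1 - 1 ⊗ X` and
-- the second is the action. It resolves an `A[X]`-module by modules extended from `A`, at the cost
-- of one more step.
open Polynomial in
lemma exists_shortExact_polynomial {A : Type u} [CommRing A] (M : Type u) [AddCommGroup M]
    [Module A M] [Module A[X] M] [IsScalarTower A A[X] M] :
    ∃ (f : A[X] ⊗[A] M →ₗ[A[X]] A[X] ⊗[A] M) (g : A[X] ⊗[A] M →ₗ[A[X]] M),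
      Function.Injective f ∧ Function.Exact f g ∧ Function.Surjective g := by
  let x : M →ₗ[A] M := (LinearMap.lsmul A[X] M Polynomial.X).restrictScalars A
  let f : A[X] ⊗[A] M →ₗ[A[X]] A[X] ⊗[A] M :=
    LinearMap.lsmul A[X] _ Polynomial.X - x.baseChange A[X]
  let g : A[X] ⊗[A] M →ₗ[A[X]] M := LinearMap.liftBaseChange A[X] LinearMap.id
  have hf : ∀ p m, f (p ⊗ₜ m) = (Polynomial.X * p) ⊗ₜ m - p ⊗ₜ ((Polynomial.X : A[X]) • m) := fun p m => by
    simp [f, x, smul_tmul']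
  have hg : ∀ p m, g (p ⊗ₜ m) = p • m := fun p m => by simp [g]
  refine ⟨f, g, ?_, ?_, ?_⟩
  · let e := TensorProduct.equivFinsuppOfBasisLeft (N := M) (Polynomial.basisMonomials A)
    let c : ℕ → A[X] ⊗[A] M →ₗ[A] M := fun n => Finsupp.lapply n ∘ₗ e.toLinearMap
    have hc : ∀ n p m, c n (p ⊗ₜ m) = p.coeff n • m := fun n p m => by
      simp [c, e, Polynomial.basisMonomials]
      rfl
    have hcf : ∀ n h, c (n + 1) (f h) = c n h - (Polynomial.X : A[X]) • c (n + 1) h := by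
      intro n h
      induction h using TensorProduct.induction_on with
      | zero => simp
      | add a b ha hb => simp only [map_add, ha, hb, smul_add]; abel
      | tmul p m => rw [hf, map_sub, hc, hc, hc, hc, Polynomial.coeff_X_mul, smul_comm]
    rw [injective_iff_map_eq_zero]
    intro h h0
    have hstep : ∀ n, c n h = (Polynomial.X : A[X]) • c (n + 1) h := fun n => by
      have := hcf n h
      rw [h0, map_zero] at this
      exact (sub_eq_zero.1 this.symm)
    -- An element of the kernel satisfies `c n h = X • c (n + 1) h`; as its high coefficients
    -- vanish, descending induction kills all of them.
    obtain ⟨N, hN⟩ : ∃ N, ∀ n, N ≤ n → c n h = 0 := by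
      refine ⟨(e h).support.sup id + 1, fun n hn => ?_⟩
      by_contra hne
      have : n ≤ (e h).support.sup id := Finset.le_sup (f := id) (Finsupp.mem_support_iff.2 hne)
      omega
    have hzero : ∀ j n, N ≤ n + j → c n h = 0 := by
      intro j
      induction j with
      | zero => exact fun n hn => hN n hn
      | succ j ih => exact fun n hn => by rw [hstep, ih (n + 1) (by omega), smul_zero]
    refine (map_eq_zero_iff e e.injective).1 ?_
    ext n
    exact hzero N n (by omega)
  -- Modulo the image of `f`, each factor `X` can be moved across the tensor sign, so every `h` is
  -- congruent to `1 ⊗ g h`.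
  · have key : ∀ h, h - 1 ⊗ₜ g h ∈ LinearMap.range f := by
      intro h
      induction h using TensorProduct.induction_on with
      | zero => simp
      | add a b ha hb =>
        have := add_mem ha hb
        rw [map_add, tmul_add]
        convert this using 1
        abel
      | tmul p m =>
        rw [hg]
        induction p using Polynomial.induction_on' generalizing m with
        | add p q hp hq =>
          have := add_mem (hp m) (hq m)
          rw [add_tmul, add_smul, tmul_add]
          convert this using 1
          abel
        | monomial n a =>
          induction n generalizing m with
          | zero =>
            have : (monomial 0 a : A[X]) = a • 1 := by simp [Polynomial.smul_eq_C_mul]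
            rw [this, smul_tmul, smul_assoc, one_smul, sub_self]
            exact zero_mem _
          | succ n ih =>
            have h1 := add_mem (ih ((Polynomial.X : A[X]) • m)) (LinearMap.mem_range_self f (monomial n a ⊗ₜ m))
            rw [hf] at h1
            have h2 : (monomial (n + 1) a : A[X]) = Polynomial.X * monomial n a := by
              rw [X_mul_monomial]
            have h3 : (monomial n a : A[X]) • (Polynomial.X : A[X]) • m = (monomial (n + 1) a : A[X]) • m := by
              rw [smul_smul, h2, mul_comm]
            rw [h3, ← h2] at h1
            convert h1 using 1
            abel
    intro h
    constructor
    · intro h0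
      have := key h
      rwa [h0, tmul_zero, sub_zero] at this
    · rintro ⟨y, rfl⟩
      induction y using TensorProduct.induction_on with
      | zero => simp
      | add a b ha hb => rw [map_add, map_add, ha, hb, add_zero]
      | tmul p m => rw [hf, map_sub, hg, hg, smul_smul, mul_comm, sub_self]
  · intro m
    exact ⟨1 ⊗ₜ m, by rw [hg, one_smul]⟩

/-- The modules over `A` have bounded projective dimension. -/
def FiniteGlobalDimension (A : Type u) [CommRing A] : Prop :=
  ∃ n : ℕ, ∀ (M : Type u) [AddCommGroup M] [Module A M],
    HasProjectiveDimensionLT (ModuleCat.of A M) (n + 1)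

lemma FiniteGlobalDimension.of_field (k : Type u) [Field k] : FiniteGlobalDimension k :=
  ⟨0, fun M _ _ => by
    rw [zero_add, ← projective_iff_hasProjectiveDimensionLT_one, ← IsProjective.iff_projective]
    infer_instance⟩

open Polynomial in
lemma FiniteGlobalDimension.polynomial {A : Type u} [CommRing A] (h : FiniteGlobalDimension A) :
    FiniteGlobalDimension A[X] := by
  obtain ⟨n, hn⟩ := h
  refine ⟨n + 1, fun M _ _ => ?_⟩
  let := Module.compHom M (algebraMap A A[X])
  have : IsScalarTower A A[X] M := IsScalarTower.of_algebraMap_smul fun _ _ => rfl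
  obtain ⟨f, g, hf, hfg, hg⟩ := exists_shortExact_polynomial (A := A) M
  have h1 := hasProjectiveDimensionLT_tensorProduct A[X] n M (hn M)
  exact (shortExact_of_exact f g hf hfg hg).hasProjectiveDimensionLT_X₃ (n + 1) h1
    (hasProjectiveDimensionLT_of_ge _ (n + 1) _ (by omega))

attribute [local instance] RingHomInvPair.of_ringEquiv in
lemma FiniteGlobalDimension.of_ringEquiv {A B : Type u} [CommRing A] [CommRing B] (e : A ≃+* B)
    (h : FiniteGlobalDimension A) : FiniteGlobalDimension B := by
  obtain ⟨n, hn⟩ := h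
  refine ⟨n, fun M _ _ => ?_⟩
  let := Module.compHom M (e : A →+* B)
  have := hn M
  let e' : ModuleCat.of A M ≃ₛₗ[RingHomClass.toRingHom e] ModuleCat.of B M :=
    { AddEquiv.refl M with map_smul' := fun _ _ => rfl }
  exact ModuleCat.hasProjectiveDimensionLE_of_semiLinearEquiv e e' n

theorem finiteGlobalDimension_mvPolynomial (k : Type u) [Field k] (σ : Type) [Finite σ] :
    FiniteGlobalDimension (MvPolynomial σ k) := by
  induction σ using Finite.induction_empty_option with
  | of_equiv e h => exact h.of_ringEquiv (renameEquiv k e).toRingEquiv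
  | h_empty => exact (FiniteGlobalDimension.of_field k).of_ringEquiv (isEmptyRingEquiv k PEmpty).symm
  | h_option h => exact h.polynomial.of_ringEquiv (optionEquivLeft k _).symm.toRingEquiv

end Syzygy

end Multigraded

namespace Multigraded

/-! ### Homogeneous submodules of graded free modules -/

section Homogeneous

variable {k : Type*} [Field k] {σ ι : Type*} {w : σ → (ι → ℤ)}

lemma weightedHomogeneousComponent_mul {f q : MvPolynomial σ k} {b : ι → ℤ}
    (hq : IsWeightedHomogeneous w q b) (a : ι → ℤ) :
    weightedHomogeneousComponent w a (f * q) = weightedHomogeneousComponent w (a - b) f * q := by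
  classical
  induction f using MvPolynomial.induction_on' with
  | add p p' hp hp' => simp only [add_mul, map_add, hp, hp']
  | monomial d c =>
    have h1 := isWeightedHomogeneous_monomial w d c rfl
    have h2 := h1.mul hq
    rw [weightedHomogeneousComponent_of_mem h1, weightedHomogeneousComponent_of_mem h2]
    by_cases h : a = Finsupp.weight w d + b
    · rw [if_pos h, if_pos (by rw [h, add_sub_cancel_right])]
    · rw [if_neg h, if_neg (fun h' => h (by rw [← h', sub_add_cancel])), zero_mul]

/-- An ideal is homogeneous if it contains the homogeneous components of its elements. -/
lemma IsHomogeneousIdeal.weightedHomogeneousComponent_mem {I : Ideal (MvPolynomial σ k)}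
    (hI : IsHomogeneousIdeal w I) {f : MvPolynomial σ k} (hf : f ∈ I) (a : ι → ℤ) :
    weightedHomogeneousComponent w a f ∈ I := by
  classical
  let := weightedGradedAlgebra k w
  exact MvPolynomial.weightedHomogeneousComponent_mem_of_mem k w hI hf a

/-- A homogeneous vector of degree `a` of the graded free module `⨁_j R(-b_j)`. -/
def IsHomogeneousVector (w : σ → (ι → ℤ)) {m : ℕ} (b : Fin m → (ι → ℤ)) (a : ι → ℤ)
    (v : Fin m → MvPolynomial σ k) : Prop :=
  ∀ j, IsWeightedHomogeneous w (v j) (a - b j)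

/-- The component of degree `a` of a vector of the graded free module `⨁_j R(-b_j)`. -/
def vectorComponent (w : σ → (ι → ℤ)) {m : ℕ} (b : Fin m → (ι → ℤ)) (a : ι → ℤ) :
    (Fin m → MvPolynomial σ k) →ₗ[k] (Fin m → MvPolynomial σ k) :=
  LinearMap.pi fun j => weightedHomogeneousComponent w (a - b j) ∘ₗ LinearMap.proj j

lemma vectorComponent_apply {m : ℕ} (b : Fin m → (ι → ℤ)) (a : ι → ℤ)
    (v : Fin m → MvPolynomial σ k) (j : Fin m) :
    vectorComponent w b a v j = weightedHomogeneousComponent w (a - b j) (v j) := rfl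

lemma isHomogeneousVector_vectorComponent {m : ℕ} (b : Fin m → (ι → ℤ)) (a : ι → ℤ)
    (v : Fin m → MvPolynomial σ k) : IsHomogeneousVector w b a (vectorComponent w b a v) :=
  fun _ => weightedHomogeneousComponent_isWeightedHomogeneous _ _

lemma IsHomogeneousVector.vectorComponent_eq {m : ℕ} {b : Fin m → (ι → ℤ)} {a : ι → ℤ}
    {v : Fin m → MvPolynomial σ k} (hv : IsHomogeneousVector w b a v) :
    vectorComponent w b a v = v :=
  funext fun j => (hv j).weightedHomogeneousComponent_same

lemma exists_eq_sum_vectorComponent {m : ℕ} (b : Fin m → (ι → ℤ)) (v : Fin m → MvPolynomial σ k) :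
    ∃ s : Finset (ι → ℤ), v = ∑ a ∈ s, vectorComponent w b a v := by
  classical
  have hfin : ∀ j, (Function.support fun a => weightedHomogeneousComponent w (a - b j) (v j)).Finite := by
    intro j
    refine ((weightedHomogeneousComponent_finsupp (w := w) (v j)).image (· + b j)).subset ?_
    intro a ha
    exact ⟨a - b j, ha, sub_add_cancel _ _⟩
  refine ⟨Finset.univ.biUnion fun j => (hfin j).toFinset, funext fun j => ?_⟩
  rw [Finset.sum_apply]
  simp only [vectorComponent_apply]
  rw [← finsum_eq_sum_of_support_subset]
  · rw [← finsum_comp_equiv (Equiv.addRight (b j))]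
    simpa using (finsum_weightedHomogeneousComponent w (v j)).symm
  · intro a ha
    exact Finset.mem_coe.2 (Finset.mem_biUnion.2
      ⟨j, Finset.mem_univ _, (hfin j).mem_toFinset.2 ha⟩)

/-- Maps of degree zero between graded free modules commute with taking components. -/
lemma map_vectorComponent {m n : ℕ} {b : Fin m → (ι → ℤ)} {c : Fin n → (ι → ℤ)}
    (d : (Fin n → MvPolynomial σ k) →ₗ[MvPolynomial σ k] (Fin m → MvPolynomial σ k))
    (hd : ∀ i, IsHomogeneousVector w b (c i) (d (Pi.single i 1))) (a : ι → ℤ)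
    (v : Fin n → MvPolynomial σ k) :
    d (vectorComponent w c a v) = vectorComponent w b a (d v) := by
  classical
  ext1 j
  rw [LinearMap.pi_apply_eq_sum_univ d v, LinearMap.pi_apply_eq_sum_univ d (vectorComponent w c a v),
    vectorComponent_apply, Finset.sum_apply, Finset.sum_apply, map_sum]
  refine Finset.sum_congr rfl fun i _ => ?_
  have h : (fun j => if i = j then (1 : MvPolynomial σ k) else 0) = Pi.single i 1 := by
    ext1 j
    simp [Pi.single_apply, eq_comm]
  rw [h, Pi.smul_apply, Pi.smul_apply, smul_eq_mul, smul_eq_mul,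
    weightedHomogeneousComponent_mul (hd i j), vectorComponent_apply]
  congr 3
  abel

/-- The submodule `N` is generated by `n` homogeneous vectors. -/
def HasHomogeneousGenerators (w : σ → (ι → ℤ)) {m : ℕ} (b : Fin m → (ι → ℤ))
    (N : Submodule (MvPolynomial σ k) (Fin m → MvPolynomial σ k)) (n : ℕ) : Prop :=
  ∃ (g : Fin n → Fin m → MvPolynomial σ k) (c : Fin n → (ι → ℤ)),
    (∀ i, IsHomogeneousVector w b (c i) (g i)) ∧ Submodule.span _ (Set.range g) = N

lemma exists_hasHomogeneousGenerators [Finite σ] {m : ℕ} (b : Fin m → (ι → ℤ))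
    (N : Submodule (MvPolynomial σ k) (Fin m → MvPolynomial σ k))
    (hN : ∀ v ∈ N, ∀ a, vectorComponent w b a v ∈ N) :
    ∃ n, HasHomogeneousGenerators w b N n := by
  set s : Set (Fin m → MvPolynomial σ k) := {v | v ∈ N ∧ ∃ a, IsHomogeneousVector w b a v} with hs
  have hspan : Submodule.span (MvPolynomial σ k) s = N := by
    apply le_antisymm
    · exact Submodule.span_le.2 fun v hv => hv.1
    · intro v hv
      obtain ⟨t, ht⟩ := exists_eq_sum_vectorComponent (w := w) b v
      rw [ht]
      exact Submodule.sum_mem _ fun a _ => Submodule.subset_span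
        ⟨hN v hv a, a, isHomogeneousVector_vectorComponent b a v⟩
  obtain ⟨t, hts, ht⟩ := (Submodule.fg_span_iff_fg_span_finset_subset s).1
    (hspan ▸ IsNoetherian.noetherian N)
  choose c hc using fun v : t => (hts v.2).2
  refine ⟨t.card, fun i => t.equivFin.symm i, fun i => c (t.equivFin.symm i),
    fun i => hc _, ?_⟩
  rw [← hspan, ht]
  congr 1
  ext v
  constructor
  · rintro ⟨i, rfl⟩
    exact (t.equivFin.symm i).2
  · intro hv
    exact ⟨t.equivFin ⟨v, hv⟩, by simp⟩

/-- A relation with a nonzero constant coefficient can be solved for the corresponding generator,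
which is then redundant. This plays the role of Nakayama's lemma. -/
lemma hasHomogeneousGenerators_of_relation {m : ℕ} {b : Fin m → (ι → ℤ)}
    {N : Submodule (MvPolynomial σ k) (Fin m → MvPolynomial σ k)} {n n' : ℕ} (hn : n' = n + 1)
    {g : Fin n' → Fin m → MvPolynomial σ k} {c : Fin n' → (ι → ℤ)}
    (hg : ∀ i, IsHomogeneousVector w b (c i) (g i)) (hs : Submodule.span _ (Set.range g) = N)
    {v : Fin n' → MvPolynomial σ k} (hv : ∑ i, v i • g i = 0) {j : Fin n'} {u : k} (hu : u ≠ 0)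
    (hj : v j = C u) : HasHomogeneousGenerators w b N n := by
  subst hn
  refine ⟨g ∘ j.succAbove, c ∘ j.succAbove, fun i => hg _, ?_⟩
  rw [← hs]
  apply le_antisymm
  · exact Submodule.span_mono (Set.range_comp_subset_range _ _)
  · rw [Submodule.span_le]
    rintro _ ⟨i, rfl⟩
    by_cases hi : i = j
    · subst hi
      rw [Fin.sum_univ_succAbove _ i, hj] at hv
      have h1 : g i = (-C u⁻¹ : MvPolynomial σ k) •
          ∑ x, v (i.succAbove x) • g (i.succAbove x) := by
        rw [← neg_eq_of_add_eq_zero_right hv, smul_neg, neg_smul, neg_neg, smul_smul, ← C_mul,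
          inv_mul_cancel₀ hu, C_1, one_smul]
      rw [h1]
      exact Submodule.smul_mem _ _ (Submodule.sum_mem _ fun x _ =>
        Submodule.smul_mem _ _ (Submodule.subset_span ⟨x, rfl⟩))
    · obtain ⟨x, rfl⟩ := Fin.exists_succAbove_eq hi
      exact Submodule.subset_span ⟨x, rfl⟩

/-- The functional `l`, positive on the degrees of all variables, expresses positivity of the
grading, here and in all that follows. -/
lemma eq_zero_of_map_weight_nonpos (l : (ι → ℤ) →+ ℤ) (hl : ∀ a, 0 < l (w a)) {d : σ →₀ ℕ}
    (hd : l (Finsupp.weight w d) ≤ 0) : d = 0 := by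
  rw [Finsupp.weight_apply, Finsupp.sum, map_sum] at hd
  have hnn : ∀ i ∈ d.support, 0 ≤ l (d i • w i) := fun i _ => by
    rw [map_nsmul]; exact nsmul_nonneg (hl i).le _
  have h0 := (Finset.sum_eq_zero_iff_of_nonneg hnn).1 (le_antisymm hd (Finset.sum_nonneg hnn))
  ext i
  by_contra hi
  have := h0 i (Finsupp.mem_support_iff.2 hi)
  rw [map_nsmul, smul_eq_zero] at this
  exact this.elim hi (hl i).ne'

lemma isWeightedHomogeneous_zero_eq_C (l : (ι → ℤ) →+ ℤ) (hl : ∀ a, 0 < l (w a))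
    {f : MvPolynomial σ k} (hf : IsWeightedHomogeneous w f 0) : f = C (constantCoeff f) := by
  classical
  ext d
  rw [coeff_C]
  split_ifs with h
  · rw [← h]; rfl
  · by_contra hne
    exact h (eq_zero_of_map_weight_nonpos l hl (by rw [hf hne, map_zero])).symm

end Homogeneous

/-- A homogeneous submodule of a graded free module of finite rank. -/
structure HomogeneousSubmodule (k : Type*) [Field k] {σ ι : Type*} (w : σ → (ι → ℤ)) where
  rank : ℕ
  shift : Fin rank → (ι → ℤ)
  carrier : Submodule (MvPolynomial σ k) (Fin rank → MvPolynomial σ k)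
  vectorComponent_mem : ∀ v ∈ carrier, ∀ a, vectorComponent w shift a v ∈ carrier

namespace HomogeneousSubmodule

variable {k : Type*} [Field k] {σ ι : Type*} [Finite σ] {w : σ → (ι → ℤ)}
  (N : HomogeneousSubmodule k w)

open Classical in
/-- The minimal number of homogeneous generators. -/
def numGenerators : ℕ :=
  Nat.find (exists_hasHomogeneousGenerators N.shift N.carrier N.vectorComponent_mem)

lemma hasHomogeneousGenerators :
    HasHomogeneousGenerators w N.shift N.carrier N.numGenerators := by
  classical
  exact Nat.find_spec (exists_hasHomogeneousGenerators N.shift N.carrier N.vectorComponent_mem)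

lemma numGenerators_le {n : ℕ} (h : HasHomogeneousGenerators w N.shift N.carrier n) :
    N.numGenerators ≤ n := by
  classical
  exact Nat.find_min' _ h

/-- A minimal system of homogeneous generators. -/
def generator : Fin N.numGenerators → Fin N.rank → MvPolynomial σ k :=
  N.hasHomogeneousGenerators.choose

/-- The degrees of the generators. -/
def degree : Fin N.numGenerators → (ι → ℤ) :=
  N.hasHomogeneousGenerators.choose_spec.choose

lemma isHomogeneousVector_generator (i : Fin N.numGenerators) :
    IsHomogeneousVector w N.shift (N.degree i) (N.generator i) :=
  N.hasHomogeneousGenerators.choose_spec.choose_spec.1 i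

lemma span_generator : Submodule.span _ (Set.range N.generator) = N.carrier :=
  N.hasHomogeneousGenerators.choose_spec.choose_spec.2

/-- The minimal graded free cover. -/
def cover : (Fin N.numGenerators → MvPolynomial σ k) →ₗ[MvPolynomial σ k]
    (Fin N.rank → MvPolynomial σ k) :=
  Fintype.linearCombination (MvPolynomial σ k) N.generator

lemma cover_single (i : Fin N.numGenerators) : N.cover (Pi.single i 1) = N.generator i := by
  simp [cover]

lemma isHomogeneousVector_cover_single (i : Fin N.numGenerators) :
    IsHomogeneousVector w N.shift (N.degree i) (N.cover (Pi.single i 1)) := by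
  rw [cover_single]
  exact N.isHomogeneousVector_generator i

lemma range_cover : LinearMap.range N.cover = N.carrier := by
  rw [cover, Fintype.range_linearCombination, span_generator]

/-- The first syzygy module. -/
def syzygy : HomogeneousSubmodule k w where
  rank := N.numGenerators
  shift := N.degree
  carrier := LinearMap.ker N.cover
  vectorComponent_mem v hv a := by
    rw [LinearMap.mem_ker] at hv ⊢
    rw [map_vectorComponent (b := N.shift) N.cover N.isHomogeneousVector_cover_single, hv, map_zero]

/-- The component of `v` in the degree of the `j`-th generator is again a relation, and its `j`-th
entry has degree zero, hence is the constant term of `v j`. If that were nonzero, the generating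
system would not be minimal. -/
lemma constantCoeff_eq_zero_of_mem_ker (l : (ι → ℤ) →+ ℤ) (hl : ∀ a, 0 < l (w a))
    {v : Fin N.numGenerators → MvPolynomial σ k} (hv : N.cover v = 0) (j : Fin N.numGenerators) :
    constantCoeff (v j) = 0 := by
  by_contra hne
  have hv' := N.syzygy.vectorComponent_mem v hv (N.degree j)
  set v' := vectorComponent w N.degree (N.degree j) v with hv'_def
  replace hv' : N.cover v' = 0 := hv'
  have hj : v' j = C (constantCoeff (v j)) := by
    have h1 : v' j = weightedHomogeneousComponent w 0 (v j) := by
      rw [hv'_def, vectorComponent_apply, sub_self]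
    rw [h1, isWeightedHomogeneous_zero_eq_C l hl
      (weightedHomogeneousComponent_isWeightedHomogeneous 0 (v j))]
    classical
    congr 1
    rw [constantCoeff_eq, coeff_weightedHomogeneousComponent, if_pos (map_zero _)]
  obtain ⟨n, hn⟩ : ∃ n, N.numGenerators = n + 1 := Nat.exists_eq_succ_of_ne_zero
    (Nat.ne_of_gt (Nat.lt_of_le_of_lt (Nat.zero_le _) j.2))
  have := N.numGenerators_le (hasHomogeneousGenerators_of_relation hn
    N.isHomogeneousVector_generator N.span_generator hv' hne hj)
  omega

/-- A splitting of the cover gives a projection `e` onto its kernel. By minimality, kernel vectors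
have entries in the ideal `𝔪` of the variables; expanding `v = e v` in the standard basis improves
`𝔪 ^ n` to `𝔪 ^ (n + 1)`, and Krull's intersection theorem finishes. -/
lemma cover_injective_of_projective (l : (ι → ℤ) →+ ℤ) (hl : ∀ a, 0 < l (w a))
    [Module.Projective (MvPolynomial σ k) N.carrier] : LinearMap.ker N.cover = ⊥ := by
  let π : (Fin N.numGenerators → MvPolynomial σ k) →ₗ[MvPolynomial σ k] N.carrier :=
    N.cover.codRestrict N.carrier fun v => by
      rw [← N.range_cover]; exact LinearMap.mem_range_self _ _
  have hπ : Function.Surjective π := by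
    rintro ⟨x, hx⟩
    rw [← N.range_cover] at hx
    obtain ⟨v, rfl⟩ := hx
    exact ⟨v, rfl⟩
  obtain ⟨s, hs⟩ := Module.projective_lifting_property π LinearMap.id hπ
  let e := LinearMap.id - s ∘ₗ π
  have he : ∀ v, N.cover (e v) = 0 := by
    intro v
    have h1 : π (e v) = 0 := by
      have := LinearMap.congr_fun hs (π v)
      simp only [LinearMap.comp_apply, LinearMap.id_apply] at this
      simp [e, this]
    exact congrArg Subtype.val h1
  have he' : ∀ v, N.cover v = 0 → e v = v := by
    intro v hv
    have h1 : π v = 0 := Subtype.ext hv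
    simp [e, h1]
  set 𝔪 : Ideal (MvPolynomial σ k) := RingHom.ker constantCoeff with h𝔪
  have key : ∀ n v, N.cover v = 0 → ∀ j, v j ∈ 𝔪 ^ n := by
    intro n
    induction n with
    | zero => simp
    | succ n ih =>
      classical
      intro v hv j
      rw [← he' v hv, LinearMap.pi_apply_eq_sum_univ e v, Finset.sum_apply, pow_succ']
      refine Ideal.sum_mem _ fun i _ => ?_
      exact Ideal.mul_mem_mul (N.constantCoeff_eq_zero_of_mem_ker l hl hv i) (ih _ (he _) j)
  rw [eq_bot_iff]
  intro v hv
  rw [Submodule.mem_bot]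
  ext1 j
  have hne : 𝔪 ≠ ⊤ := RingHom.ker_ne_top _
  have := Ideal.iInf_pow_eq_bot_of_isDomain 𝔪 hne
  rw [Pi.zero_apply, ← Ideal.mem_bot, ← this, Ideal.mem_iInf]
  exact fun n => key n v hv j

end HomogeneousSubmodule

end Multigraded

namespace Multigraded

/-! ### Existence of finite graded free resolutions -/

section Existence

open CategoryTheory

universe u

variable {k : Type u} [Field k] {σ : Type} {ι : Type*} {w : σ → (ι → ℤ)}

/-- The zeroth module of the resolution of `R / I` is `R`. -/
def quotientAugmentation (I : Ideal (MvPolynomial σ k)) :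
    (Fin 1 → MvPolynomial σ k) →ₗ[MvPolynomial σ k] MvPolynomial σ k ⧸ I :=
  (Submodule.mkQ I) ∘ₗ LinearMap.proj 0

lemma quotientAugmentation_single_mem (I : Ideal (MvPolynomial σ k)) (j : Fin 1) :
    quotientAugmentation I (Pi.single j 1) ∈ quotientGrading w I 0 := by
  refine ⟨1, isWeightedHomogeneous_one k w, ?_⟩
  rw [Subsingleton.elim j 0]
  rfl

variable [Finite σ]

/-- The sequence of minimal syzygy modules. -/
def HomogeneousSubmodule.iterate (N : HomogeneousSubmodule k w) : ℕ → HomogeneousSubmodule k w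
  | 0 => N
  | i + 1 => (N.iterate i).syzygy

namespace HomogeneousSubmodule

lemma hasProjectiveDimensionLT_syzygy (N : HomogeneousSubmodule k w) (n : ℕ)
    (h : HasProjectiveDimensionLT (ModuleCat.of (MvPolynomial σ k) N.carrier) (n + 2)) :
    HasProjectiveDimensionLT (ModuleCat.of (MvPolynomial σ k) N.syzygy.carrier) (n + 1) := by
  let π : (Fin N.numGenerators → MvPolynomial σ k) →ₗ[MvPolynomial σ k] N.carrier :=
    N.cover.codRestrict N.carrier fun v => by
      rw [← N.range_cover]; exact LinearMap.mem_range_self _ _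
  have hπ : Function.Surjective π := by
    rintro ⟨x, hx⟩
    rw [← N.range_cover] at hx
    obtain ⟨v, rfl⟩ := hx
    exact ⟨v, rfl⟩
  have hex : Function.Exact (LinearMap.ker N.cover).subtype π := by
    intro v
    constructor
    · intro hv
      exact ⟨⟨v, congrArg Subtype.val hv⟩, rfl⟩
    · rintro ⟨⟨v, hv⟩, rfl⟩
      exact Subtype.ext hv
  have hS := shortExact_of_exact _ _ (Submodule.subtype_injective _) hex hπ
  exact (hS.hasProjectiveDimensionLT_X₃_iff n
    ((IsProjective.iff_projective _).1 inferInstance)).1 h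

lemma exists_iterate_carrier_eq_bot (l : (ι → ℤ) →+ ℤ) (hl : ∀ a, 0 < l (w a))
    (N : HomogeneousSubmodule k w) : ∃ n, ∀ i, n ≤ i → (N.iterate i).carrier = ⊥ := by
  obtain ⟨n, hn⟩ := finiteGlobalDimension_mvPolynomial k σ
  have h1 : ∀ i j, i + j = n →
      HasProjectiveDimensionLT (ModuleCat.of (MvPolynomial σ k) (N.iterate i).carrier) (j + 1) := by
    intro i
    induction i with
    | zero =>
      rintro j rfl
      have h := hn N.carrier
      rwa [zero_add] at h
    | succ i ih =>
      intro j hj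
      exact hasProjectiveDimensionLT_syzygy _ _ (ih (j + 1) (by omega))
  have h2 := h1 n 0 rfl
  rw [zero_add, ← projective_iff_hasProjectiveDimensionLT_one, ← IsProjective.iff_projective] at h2
  have h3 : (N.iterate (n + 1)).carrier = ⊥ :=
    (N.iterate n).cover_injective_of_projective l hl
  refine ⟨n + 1, fun i hi => ?_⟩
  -- Once zero, the syzygies stay zero: the zero module is projective, so its minimal cover is
  -- injective as well.
  induction i, hi using Nat.le_induction with
  | base => exact h3
  | succ i hi ih =>
    have : Module.Projective (MvPolynomial σ k) (N.iterate i).carrier := by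
      rw [ih]; infer_instance
    exact (N.iterate i).cover_injective_of_projective l hl

lemma cover_eq_zero_iff (N : HomogeneousSubmodule k w) (v : Fin N.numGenerators → MvPolynomial σ k) :
    N.cover v = 0 ↔ ∃ v', N.syzygy.cover v' = v := by
  have h : v ∈ LinearMap.range N.syzygy.cover ↔ v ∈ LinearMap.ker N.cover := by
    rw [range_cover]; rfl
  exact h.symm

lemma numGenerators_eq_zero (N : HomogeneousSubmodule k w) (h : N.carrier = ⊥) :
    N.numGenerators = 0 := by
  refine Nat.le_zero.1 (N.numGenerators_le ⟨Fin.elim0, Fin.elim0, fun i => i.elim0, ?_⟩)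
  rw [h, Set.range_eq_empty, Submodule.span_empty]

end HomogeneousSubmodule

/-- A homogeneous ideal as a homogeneous submodule of the free module of rank one. -/
def idealSubmodule (I : Ideal (MvPolynomial σ k)) (hI : IsHomogeneousIdeal w I) :
    HomogeneousSubmodule k w where
  rank := 1
  shift _ := 0
  carrier := Submodule.comap (LinearMap.proj 0) I
  vectorComponent_mem v hv a := by
    rw [Submodule.mem_comap, LinearMap.proj_apply] at hv ⊢
    exact hI.weightedHomogeneousComponent_mem hv _

lemma quotientAugmentation_eq_zero_iff (I : Ideal (MvPolynomial σ k)) (hI : IsHomogeneousIdeal w I)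
    (v : Fin 1 → MvPolynomial σ k) :
    quotientAugmentation I v = 0 ↔ ∃ v', (idealSubmodule I hI).cover v' = v := by
  have h : v ∈ LinearMap.range (idealSubmodule I hI).cover ↔ v ∈ (idealSubmodule I hI).carrier := by
    rw [HomogeneousSubmodule.range_cover]
  exact (Submodule.Quotient.mk_eq_zero I).trans h.symm

theorem exists_gradedFreeResolution (l : (ι → ℤ) →+ ℤ) (hl : ∀ a, 0 < l (w a))
    (I : Ideal (MvPolynomial σ k)) (hI : IsHomogeneousIdeal w I) :
    Nonempty (GradedFreeResolution k w (quotientGrading w I)) := by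
  set N := idealSubmodule I hI with hN
  obtain ⟨n, hn⟩ := N.exists_iterate_carrier_eq_bot l hl
  exact ⟨{
    -- The module in position `j + 1` has rank the number of generators of the `j`-th iterated
    -- syzygy module, which is zero for `j ≥ n`.
    length := n
    rank := fun i => (N.iterate i).rank
    rank_eq_zero := fun i hi => by
      obtain ⟨j, rfl⟩ : ∃ j, i = j + 1 := ⟨i - 1, by omega⟩
      exact (N.iterate j).numGenerators_eq_zero (hn j (by omega))
    shift := fun i => (N.iterate i).shift
    d := fun i => (N.iterate i).cover
    d_homogeneous := fun i j m => (N.iterate i).isHomogeneousVector_cover_single j m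
    aug := quotientAugmentation I
    aug_homogeneous := quotientAugmentation_single_mem I
    exact_d := fun i v => (N.iterate i).cover_eq_zero_iff v
    exact_aug := fun v => quotientAugmentation_eq_zero_iff I hI v
    aug_surjective := fun x => by
      obtain ⟨f, rfl⟩ := Submodule.mkQ_surjective I x
      exact ⟨fun _ => f, rfl⟩ }⟩

end Existence

end Multigraded

namespace Multigraded

/-! ### Flat base change of graded free resolutions -/

section BaseChange

variable {k : Type*} [Field k] {σ τ ι : Type*} {w : σ → (ι → ℤ)} {w' : τ → (ι → ℤ)}

/-- The image of a homogeneous ideal under a ring homomorphism of degree zero is homogeneous. -/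
lemma IsHomogeneousIdeal.map {I : Ideal (MvPolynomial σ k)} (hI : IsHomogeneousIdeal w I)
    (f : MvPolynomial σ k →+* MvPolynomial τ k)
    (hf : ∀ q a, IsWeightedHomogeneous w q a → IsWeightedHomogeneous w' (f q) a) :
    IsHomogeneousIdeal w' (I.map f) := by
  classical
  let := weightedGradedAlgebra k w
  let := weightedGradedAlgebra k w'
  obtain ⟨s, hs⟩ := (Ideal.IsHomogeneous.iff_exists (weightedHomogeneousSubmodule k w) I).1 hI
  rw [hs, Ideal.map_span]
  refine Ideal.homogeneous_span (weightedHomogeneousSubmodule k w') _ ?_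
  rintro _ ⟨_, ⟨⟨q, a, hq⟩, -, rfl⟩, rfl⟩
  exact ⟨a, hf q a hq⟩

section PiBaseChange

variable {A : Type*} (B : Type*) [CommRing A] [CommRing B] [Algebra A B]

/-- The base change of a map between finite free modules. -/
def piBaseChange {m n : ℕ} (d : (Fin n → A) →ₗ[A] (Fin m → A)) :
    (Fin n → B) →ₗ[B] (Fin m → B) :=
  (TensorProduct.piScalarRight A B B (Fin m)).toLinearMap ∘ₗ d.baseChange B ∘ₗ
    (TensorProduct.piScalarRight A B B (Fin n)).symm.toLinearMap

lemma piBaseChange_single {m n : ℕ} (d : (Fin n → A) →ₗ[A] (Fin m → A)) (j : Fin n) (i : Fin m) :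
    piBaseChange B d (Pi.single j 1) i = algebraMap A B (d (Pi.single j 1) i) := by
  simp [piBaseChange, Algebra.smul_def]

/-- The base change of a map from a finite free module to a cyclic module. -/
def quotientBaseChange {n : ℕ} {I : Ideal A} (f : (Fin n → A) →ₗ[A] A ⧸ I) :
    (Fin n → B) →ₗ[B] B ⧸ I.map (algebraMap A B) :=
  (Algebra.TensorProduct.quotIdealMapEquivTensorQuot B I).symm.toLinearEquiv.toLinearMap ∘ₗ
    f.baseChange B ∘ₗ (TensorProduct.piScalarRight A B B (Fin n)).symm.toLinearMap

lemma quotientBaseChange_single {n : ℕ} {I : Ideal A} (f : (Fin n → A) →ₗ[A] A ⧸ I) (j : Fin n)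
    (q : A) (hq : f (Pi.single j 1) = Ideal.Quotient.mk I q) :
    quotientBaseChange B f (Pi.single j 1) = Ideal.Quotient.mk _ (algebraMap A B q) := by
  have h : quotientBaseChange B f (Pi.single j 1) =
      (Algebra.TensorProduct.quotIdealMapEquivTensorQuot B I).symm
        (TensorProduct.tmul A 1 (Ideal.Quotient.mk I q)) := by
    simp [quotientBaseChange, hq]
  rw [h]
  refine (Algebra.TensorProduct.quotIdealMapEquivTensorQuot_symm_tmul B I 1 q).trans ?_
  rw [Algebra.smul_def, mul_one]
  rfl

lemma quotientBaseChange_surjective {n : ℕ} {I : Ideal A} {f : (Fin n → A) →ₗ[A] A ⧸ I}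
    (hf : Function.Surjective f) : Function.Surjective (quotientBaseChange B f) := by
  have h : Function.Surjective (f.baseChange B) := LinearMap.lTensor_surjective B hf
  exact (Algebra.TensorProduct.quotIdealMapEquivTensorQuot B I).symm.surjective.comp
    (h.comp (TensorProduct.piScalarRight A B B (Fin n)).symm.surjective)

variable [Module.Flat A B]

lemma exact_piBaseChange {l m n : ℕ} {d : (Fin l → A) →ₗ[A] (Fin m → A)}
    {d' : (Fin m → A) →ₗ[A] (Fin n → A)} (h : Function.Exact d d') :
    Function.Exact (piBaseChange B d) (piBaseChange B d') := by
  have h1 : Function.Exact (d.baseChange B) (d'.baseChange B) := Module.Flat.lTensor_exact B h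
  refine h1.of_ladder_linearEquiv_of_exact (e₁ := TensorProduct.piScalarRight A B B (Fin l))
    (e₂ := TensorProduct.piScalarRight A B B (Fin m))
    (e₃ := TensorProduct.piScalarRight A B B (Fin n)) ?_ ?_
  · refine LinearMap.ext fun x => ?_
    simp only [piBaseChange, LinearMap.comp_apply, LinearEquiv.coe_coe, LinearEquiv.symm_apply_apply]
  · refine LinearMap.ext fun x => ?_
    simp only [piBaseChange, LinearMap.comp_apply, LinearEquiv.coe_coe, LinearEquiv.symm_apply_apply]

lemma exact_quotientBaseChange {m n : ℕ} {I : Ideal A} {d : (Fin m → A) →ₗ[A] (Fin n → A)}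
    {f : (Fin n → A) →ₗ[A] A ⧸ I} (h : Function.Exact d f) :
    Function.Exact (piBaseChange B d) (quotientBaseChange B f) := by
  have h1 : Function.Exact (d.baseChange B) (f.baseChange B) := Module.Flat.lTensor_exact B h
  refine h1.of_ladder_linearEquiv_of_exact (e₁ := TensorProduct.piScalarRight A B B (Fin m))
    (e₂ := TensorProduct.piScalarRight A B B (Fin n))
    (e₃ := (Algebra.TensorProduct.quotIdealMapEquivTensorQuot B I).symm.toLinearEquiv) ?_ ?_
  · refine LinearMap.ext fun x => ?_
    simp only [piBaseChange, LinearMap.comp_apply, LinearEquiv.coe_coe, LinearEquiv.symm_apply_apply]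
  · refine LinearMap.ext fun x => ?_
    simp only [quotientBaseChange, LinearMap.comp_apply, LinearEquiv.coe_coe,
      LinearEquiv.symm_apply_apply]

end PiBaseChange

/-- Graded free resolutions are preserved by flat base change. -/
def GradedFreeResolution.baseChange [Algebra (MvPolynomial σ k) (MvPolynomial τ k)]
    [Module.Flat (MvPolynomial σ k) (MvPolynomial τ k)]
    (hw : ∀ q a, IsWeightedHomogeneous w q a →
      IsWeightedHomogeneous w' (algebraMap (MvPolynomial σ k) (MvPolynomial τ k) q) a)
    {I : Ideal (MvPolynomial σ k)} (F : GradedFreeResolution k w (quotientGrading w I)) :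
    GradedFreeResolution k w'
      (quotientGrading w' (I.map (algebraMap (MvPolynomial σ k) (MvPolynomial τ k)))) where
  length := F.length
  rank := F.rank
  rank_eq_zero := F.rank_eq_zero
  shift := F.shift
  d i := piBaseChange _ (F.d i)
  aug := quotientBaseChange _ F.aug
  d_homogeneous i j l := by
    rw [piBaseChange_single]
    exact hw _ _ (F.d_homogeneous i j l)
  aug_homogeneous j := by
    obtain ⟨q, hq, hj⟩ := F.aug_homogeneous j
    exact ⟨_, hw _ _ hq, (quotientBaseChange_single _ F.aug j q hj.symm).symm⟩
  exact_d i := exact_piBaseChange _ (F.exact_d i)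
  exact_aug := exact_quotientBaseChange _ F.exact_aug
  aug_surjective := quotientBaseChange_surjective _ F.aug_surjective

end BaseChange

end Multigraded

namespace Multigraded

/-! ### Uniqueness of the K-polynomial -/

section Hilbert

variable {k : Type*} [Field k] {σ ι : Type*} {w : σ → (ι → ℤ)}

/-- The Hilbert function of the polynomial ring. -/
def hilbert (k : Type*) [Field k] {σ ι : Type*} (w : σ → (ι → ℤ)) (a : ι → ℤ) : ℕ :=
  Module.finrank k (weightedHomogeneousSubmodule k w a)

/-- Coarsening the grading along `l` gives positive natural weights, for which graded pieces are
finite-dimensional; the fine piece lies inside a coarse one. -/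
lemma finite_weightedHomogeneousSubmodule [Finite σ] (l : (ι → ℤ) →+ ℤ) (hl : ∀ a, 0 < l (w a))
    (a : ι → ℤ) : Module.Finite k (weightedHomogeneousSubmodule k w a) := by
  set w' : σ → ℕ := fun i => (l (w i)).toNat with hw'
  have h1 : ∀ i, w' i ≠ 0 := fun i h => by
    have := hl i
    simp only [hw', Int.toNat_eq_zero] at h
    omega
  have h2 : ∀ d : σ →₀ ℕ, ((Finsupp.weight w' d : ℕ) : ℤ) = l (Finsupp.weight w d) := by
    intro d
    rw [Finsupp.weight_apply, Finsupp.weight_apply, Finsupp.sum, Finsupp.sum, map_sum, Nat.cast_sum]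
    refine Finset.sum_congr rfl fun i _ => ?_
    rw [map_nsmul, smul_eq_mul, Nat.cast_mul, Int.toNat_of_nonneg (hl i).le, nsmul_eq_mul]
  have h3 : Module.Finite k (weightedHomogeneousSubmodule k w' (l a).toNat) :=
    Module.Finite.iff_fg.2 (weightedHomogeneousSubmodule_fg k w' h1 _)
  refine Submodule.finiteDimensional_of_le
    (S₂ := weightedHomogeneousSubmodule k w' (l a).toNat) fun f hf d hd => ?_
  have h4 := h2 d
  rw [hf hd] at h4
  omega

lemma hilbert_zero_ne_zero [Finite σ] (l : (ι → ℤ) →+ ℤ) (hl : ∀ a, 0 < l (w a)) :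
    hilbert k w 0 ≠ 0 := by
  have := finite_weightedHomogeneousSubmodule (k := k) l hl 0
  intro h
  have h1 := Submodule.finrank_eq_zero.1 h
  have h2 : (1 : MvPolynomial σ k) ∈ weightedHomogeneousSubmodule k w 0 :=
    isWeightedHomogeneous_one k w
  rw [h1, Submodule.mem_bot] at h2
  exact one_ne_zero h2

lemma hilbert_eq_zero (l : (ι → ℤ) →+ ℤ) (hl : ∀ a, 0 < l (w a)) {a : ι → ℤ} (ha : l a ≤ 0)
    (ha' : a ≠ 0) : hilbert k w a = 0 := by
  have : weightedHomogeneousSubmodule k w a = ⊥ := by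
    rw [eq_bot_iff]
    intro f hf
    rw [Submodule.mem_bot]
    ext d
    by_contra hd
    have h1 : Finsupp.weight w d = a := hf hd
    have h2 := eq_zero_of_map_weight_nonpos l hl (by rw [h1]; exact ha)
    rw [h2, map_zero] at h1
    exact ha' h1.symm
  rw [hilbert, this, finrank_bot]

/-- The value at `a` of the Hilbert function with numerator `K`. -/
def hilbertPairing (k : Type*) [Field k] {σ ι : Type*} (w : σ → (ι → ℤ)) (a : ι → ℤ) :
    AddMonoidAlgebra ℤ (ι → ℤ) →ₗ[ℤ] ℤ :=
  Finsupp.linearCombination ℤ (fun b => (hilbert k w (a - b) : ℤ)) ∘ₗ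
    (AddMonoidAlgebra.coeffLinearEquiv ℤ).toLinearMap

lemma hilbertPairing_single (a b : ι → ℤ) :
    hilbertPairing k w a (AddMonoidAlgebra.single b 1) = hilbert k w (a - b) := by
  have : hilbertPairing k w a (AddMonoidAlgebra.single b 1) =
    Finsupp.linearCombination ℤ (fun b => (hilbert k w (a - b) : ℤ)) (Finsupp.single b 1) := rfl
  rw [this, Finsupp.linearCombination_single, one_smul]

/-- A Laurent polynomial is determined by the associated Hilbert function. -/
lemma eq_zero_of_hilbertPairing_eq_zero [Finite σ] (l : (ι → ℤ) →+ ℤ) (hl : ∀ a, 0 < l (w a))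
    {K : AddMonoidAlgebra ℤ (ι → ℤ)} (hK : ∀ a, hilbertPairing k w a K = 0) : K = 0 := by
  rw [← AddMonoidAlgebra.coeff_eq_zero]
  by_contra hne
  -- At an exponent `b` minimal for `l`, every other exponent `c` has `l (b - c) ≤ 0` and `b ≠ c`,
  -- so only `b` contributes: the pairing is the coefficient at `b` times the nonzero `hilbert k w
  -- 0`.
  obtain ⟨b, hb, hmin⟩ := Finset.exists_min_image K.coeff.support l
    (Finsupp.support_nonempty_iff.2 hne)
  have h1 : hilbertPairing k w b K =
    ∑ c ∈ K.coeff.support, K.coeff c * (hilbert k w (b - c) : ℤ) := rfl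
  rw [hK, Finset.sum_eq_single_of_mem b hb, sub_self, eq_comm, mul_eq_zero] at h1
  · rcases h1 with h1 | h1
    · exact Finsupp.mem_support_iff.1 hb h1
    · exact hilbert_zero_ne_zero (k := k) l hl (by exact_mod_cast h1)
  · intro c hc hcb
    rw [hilbert_eq_zero l hl (by rw [map_sub]; have := hmin c hc; omega)
      (sub_ne_zero.2 hcb.symm), Nat.cast_zero, mul_zero]

/-- The graded piece of degree `a` of `⨁_j R(-b_j)`. -/
def gradedPiece (k : Type*) [Field k] {σ ι : Type*} (w : σ → (ι → ℤ)) {m : ℕ}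
    (b : Fin m → (ι → ℤ)) (a : ι → ℤ) : Submodule k (Fin m → MvPolynomial σ k) :=
  Submodule.pi Set.univ fun j => weightedHomogeneousSubmodule k w (a - b j)

lemma mem_gradedPiece {m : ℕ} {b : Fin m → (ι → ℤ)} {a : ι → ℤ} {v : Fin m → MvPolynomial σ k} :
    v ∈ gradedPiece k w b a ↔ IsHomogeneousVector w b a v :=
  ⟨fun h j => h j (Set.mem_univ j), fun h j _ => h j⟩

/-- A graded piece of a free module is the product of graded pieces of the ring. -/
def gradedPieceEquiv {m : ℕ} (b : Fin m → (ι → ℤ)) (a : ι → ℤ) :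
    gradedPiece k w b a ≃ₗ[k] (∀ j, weightedHomogeneousSubmodule k w (a - b j)) where
  toFun v j := ⟨v.1 j, v.2 j (Set.mem_univ j)⟩
  map_add' _ _ := rfl
  map_smul' _ _ := rfl
  invFun u := ⟨fun j => (u j).1, fun j _ => (u j).2⟩
  left_inv _ := rfl
  right_inv _ := rfl

lemma finite_gradedPiece [Finite σ] (l : (ι → ℤ) →+ ℤ) (hl : ∀ a, 0 < l (w a)) {m : ℕ}
    (b : Fin m → (ι → ℤ)) (a : ι → ℤ) : Module.Finite k (gradedPiece k w b a) :=
  have := fun j => finite_weightedHomogeneousSubmodule (k := k) l hl (a - b j)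
  Module.Finite.equiv (gradedPieceEquiv b a).symm

lemma finrank_gradedPiece [Finite σ] (l : (ι → ℤ) →+ ℤ) (hl : ∀ a, 0 < l (w a)) {m : ℕ}
    (b : Fin m → (ι → ℤ)) (a : ι → ℤ) :
    Module.finrank k (gradedPiece k w b a) = ∑ j, hilbert k w (a - b j) := by
  have := fun j => finite_weightedHomogeneousSubmodule (k := k) l hl (a - b j)
  rw [(gradedPieceEquiv b a).finrank_eq, Module.finrank_pi_fintype]
  rfl

/-- A complex of graded free modules that is exact is exact in each degree. -/
lemma gradedPiece_inf_ker {m n : ℕ} {b : Fin m → (ι → ℤ)} {c : Fin n → (ι → ℤ)}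
    {d : (Fin n → MvPolynomial σ k) →ₗ[MvPolynomial σ k] (Fin m → MvPolynomial σ k)}
    (hd : ∀ i, IsHomogeneousVector w b (c i) (d (Pi.single i 1))) {M : Type*} [AddCommGroup M]
    [Module (MvPolynomial σ k) M] [Module k M] [IsScalarTower k (MvPolynomial σ k) M]
    {f : (Fin m → MvPolynomial σ k) →ₗ[MvPolynomial σ k] M} (h : Function.Exact d f) (a : ι → ℤ) :
    gradedPiece k w b a ⊓ LinearMap.ker (f.restrictScalars k) =
      (gradedPiece k w c a).map (d.restrictScalars k) := by
  ext v
  constructor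
  · rintro ⟨h1, h2⟩
    obtain ⟨u, rfl⟩ := (h v).1 h2
    refine ⟨vectorComponent w c a u,
      mem_gradedPiece.2 (isHomogeneousVector_vectorComponent _ _ _), ?_⟩
    exact (map_vectorComponent d hd a u).trans (mem_gradedPiece.1 h1).vectorComponent_eq
  · rintro ⟨u, hu, rfl⟩
    refine ⟨mem_gradedPiece.2 ?_, (h _).2 ⟨u, rfl⟩⟩
    have h1 := map_vectorComponent d hd a u
    rw [(mem_gradedPiece.1 hu).vectorComponent_eq] at h1
    rw [LinearMap.restrictScalars_apply, h1]
    exact isHomogeneousVector_vectorComponent _ _ _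

lemma finrank_map_add_finrank_inf_ker {V W : Type*} [AddCommGroup V] [Module k V] [AddCommGroup W]
    [Module k W] (f : V →ₗ[k] W) (p : Submodule k V) [Module.Finite k p] :
    Module.finrank k (p.map f) + Module.finrank k (p ⊓ LinearMap.ker f : Submodule k V) =
      Module.finrank k p := by
  rw [← LinearMap.finrank_range_add_finrank_ker (f.domRestrict p), LinearMap.range_domRestrict,
    LinearMap.ker_domRestrict, ← Submodule.map_comap_subtype, Submodule.finrank_map_subtype_eq]

end Hilbert

namespace GradedFreeResolution

variable {k : Type*} [Field k] {σ ι : Type*} {w : σ → (ι → ℤ)} {I : Ideal (MvPolynomial σ k)}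
  (F : GradedFreeResolution k w (quotientGrading w I))

/-- Any lift of a homogeneous class may be replaced by its degree-`a` component: the error lies in
`I`, and so does its component, by homogeneity of `I`. -/
lemma map_aug_gradedPiece (hI : IsHomogeneousIdeal w I) (a : ι → ℤ) :
    (gradedPiece k w (F.shift 0) a).map (F.aug.restrictScalars k) =
      (weightedHomogeneousSubmodule k w a).map (Ideal.Quotient.mkₐ k I).toLinearMap := by
  classical
  choose q hq hq' using F.aug_homogeneous
  have haug : ∀ v, F.aug v = Ideal.Quotient.mk I (∑ j, v j * q j) := by
    intro v
    rw [LinearMap.pi_apply_eq_sum_univ F.aug v, map_sum]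
    refine Finset.sum_congr rfl fun j _ => ?_
    have h : (fun i => if j = i then (1 : MvPolynomial σ k) else 0) = Pi.single j 1 := by
      ext1 i
      simp [Pi.single_apply, eq_comm]
    rw [h, ← hq' j, map_mul]
    rfl
  ext x
  constructor
  · rintro ⟨v, hv, rfl⟩
    refine ⟨∑ j, v j * q j, ?_, (haug v).symm⟩
    refine Submodule.sum_mem _ fun j _ => ?_
    have := (mem_gradedPiece.1 hv j).mul (hq j)
    rwa [sub_add_cancel] at this
  · rintro ⟨f, hf, rfl⟩
    obtain ⟨v, hv⟩ := F.aug_surjective (Ideal.Quotient.mk I f)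
    refine ⟨vectorComponent w (F.shift 0) a v,
      mem_gradedPiece.2 (isHomogeneousVector_vectorComponent _ _ _), ?_⟩
    rw [haug, Ideal.Quotient.mk_eq_mk_iff_sub_mem] at hv
    have h1 := hI.weightedHomogeneousComponent_mem hv a
    rw [map_sub, IsWeightedHomogeneous.weightedHomogeneousComponent_same hf, map_sum] at h1
    refine (haug _).trans ((Ideal.Quotient.mk_eq_mk_iff_sub_mem _ _).2 ?_)
    convert h1 using 3 with j
    exact (weightedHomogeneousComponent_mul (hq j) a).symm

/-- The Hilbert function of `R / I` is determined by the K-polynomial. -/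
lemma hilbertPairing_laurent [Finite σ] (l : (ι → ℤ) →+ ℤ) (hl : ∀ a, 0 < l (w a))
    (hI : IsHomogeneousIdeal w I) (a : ι → ℤ) :
    hilbertPairing k w a F.laurent = Module.finrank k
      ((weightedHomogeneousSubmodule k w a).map (Ideal.Quotient.mkₐ k I).toLinearMap) := by
  set f : ℕ → ℕ := fun i => ∑ j, hilbert k w (a - F.shift i j) with hf
  -- `r i` is the rank of the `i`-th differential in degree `a`. Exactness and rank–nullity give `r
  -- i + r (i + 1) = f (i + 1)`, so the alternating sum of the `f i` telescopes, with boundary term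
  -- `r F.length = 0`.
  set r : ℕ → ℕ := fun i => Module.finrank k
    ((gradedPiece k w (F.shift (i + 1)) a).map ((F.d i).restrictScalars k)) with hr
  have hfin := fun i => finite_gradedPiece (k := k) l hl (F.shift i) a
  have h0 := finrank_map_add_finrank_inf_ker (F.aug.restrictScalars k)
    (gradedPiece k w (F.shift 0) a)
  rw [gradedPiece_inf_ker (F.d_homogeneous 0) F.exact_aug, F.map_aug_gradedPiece hI,
    finrank_gradedPiece l hl] at h0
  have hsucc : ∀ i, r i + r (i + 1) = f (i + 1) := by
    intro i
    have h1 := finrank_map_add_finrank_inf_ker ((F.d i).restrictScalars k)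
      (gradedPiece k w (F.shift (i + 1)) a)
    rwa [gradedPiece_inf_ker (F.d_homogeneous (i + 1)) (F.exact_d i),
      finrank_gradedPiece l hl] at h1
  have hlast : r F.length = 0 := by
    have : IsEmpty (Fin (F.rank (F.length + 1))) := by
      rw [F.rank_eq_zero _ (Nat.lt_succ_self _)]; infer_instance
    have h1 : gradedPiece k w (F.shift (F.length + 1)) a = ⊥ := Subsingleton.elim _ _
    simp only [hr]
    rw [h1, Submodule.map_bot, finrank_bot]
  have hsum : ∀ n, ∑ i ∈ Finset.range (n + 1), (-1 : ℤ) ^ i * (f i : ℤ) =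
      (Module.finrank k ((weightedHomogeneousSubmodule k w a).map
        (Ideal.Quotient.mkₐ k I).toLinearMap) : ℤ) + (-1) ^ n * r n := by
    intro n
    induction n with
    | zero =>
      rw [Finset.sum_range_one, pow_zero, one_mul, one_mul]
      exact_mod_cast h0.symm
    | succ n ih =>
      rw [Finset.sum_range_succ, ih, ← hsucc n]
      push_cast
      ring
  have := hsum F.length
  rw [hlast, Nat.cast_zero, mul_zero, add_zero] at this
  rw [← this, laurent, map_sum]
  refine Finset.sum_congr rfl fun i _ => ?_
  have h1 : ((-1) ^ i * ∑ j, AddMonoidAlgebra.single (F.shift i j) 1 : AddMonoidAlgebra ℤ (ι → ℤ)) =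
      ((-1) ^ i : ℤ) • ∑ j, AddMonoidAlgebra.single (F.shift i j) 1 := by
    rw [zsmul_eq_mul]
    push_cast
    rfl
  rw [h1, map_smul, map_sum, smul_eq_mul]
  simp only [hilbertPairing_single, hf, Nat.cast_sum]

/-- Both alternating sums pair to the Hilbert function of `R / I`, which does not involve the
resolution. -/
theorem laurent_eq [Finite σ] (l : (ι → ℤ) →+ ℤ) (hl : ∀ a, 0 < l (w a))
    (hI : IsHomogeneousIdeal w I) (F' : GradedFreeResolution k w (quotientGrading w I)) :
    F.laurent = F'.laurent := by
  rw [← sub_eq_zero]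
  refine eq_zero_of_hilbertPairing_eq_zero (k := k) l hl fun a => ?_
  rw [map_sub, F.hilbertPairing_laurent l hl hI, F'.hilbertPairing_laurent l hl hI, sub_self]

end GradedFreeResolution

/-- The K-polynomial is computed by any finite graded free resolution. -/
lemma kPolynomial_eq {k : Type*} [Field k] {σ ι : Type*} [Finite σ] {w : σ → (ι → ℤ)}
    {I : Ideal (MvPolynomial σ k)} (l : (ι → ℤ) →+ ℤ) (hl : ∀ a, 0 < l (w a))
    (hI : IsHomogeneousIdeal w I) (F : GradedFreeResolution k w (quotientGrading w I)) :
    kPolynomial k w (quotientGrading w I) = F.laurent := by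
  have h : ∃ K, IsKPolynomial k w (quotientGrading w I) K := ⟨_, F, rfl⟩
  rw [kPolynomial, dif_pos h]
  obtain ⟨F', hF'⟩ := h.choose_spec
  rw [← hF']
  exact F'.laurent_eq l hl hI F

end Multigraded

namespace Multigraded

/-! ### Standardization -/

section Standardization

lemma isWeightedHomogeneous_doubling {k : Type*} [Field k] {σ ι : Type*} {w : σ → (ι → ℤ)}
    {w' : σ ⊕ σ → (ι → ℤ)} (hw : ∀ i, w' (Sum.inl i) + w' (Sum.inr i) = w i)
    (q : MvPolynomial σ k) (a : ι → ℤ) (hq : IsWeightedHomogeneous w q a) :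
    IsWeightedHomogeneous w' (doubling k σ q) a := by
  have h : ∀ d : σ →₀ ℕ, Finsupp.weight w' (dbl d) = Finsupp.weight w d := by
    intro d
    induction d using Finsupp.induction_linear with
    | zero => rw [dbl_zero, map_zero, map_zero]
    | add d e hd he => rw [dbl_add, map_add, map_add, hd, he]
    | single i n =>
      rw [dbl_single, map_add, Finsupp.weight_single, Finsupp.weight_single, Finsupp.weight_single,
        ← smul_add, hw]
  rw [q.as_sum, map_sum]
  refine Submodule.sum_mem (weightedHomogeneousSubmodule k w' a) fun d hd => ?_
  rw [doubling_monomial]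
  exact isWeightedHomogeneous_monomial _ _ _ ((h d).trans (hq (mem_support_iff.1 hd)))

variable (p : ℕ)

lemma degS_inl_add_degS_inr (ij : Fin p × Fin p) :
    degS p (Sum.inl ij) + degS p (Sum.inr ij) = degR p ij := rfl

/-- The total degree. -/
def totalDegreeHom : (Fin p ⊕ Fin p → ℤ) →+ ℤ where
  toFun v := ∑ i, v i
  map_zero' := Finset.sum_const_zero
  map_add' _ _ := Finset.sum_add_distrib

lemma totalDegreeHom_single (i : Fin p ⊕ Fin p) : totalDegreeHom p (Pi.single i 1) = 1 :=
  Finset.sum_pi_single' i 1 Finset.univ |>.trans (if_pos (Finset.mem_univ i))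

lemma totalDegreeHom_degS_pos (a : (Fin p × Fin p) ⊕ (Fin p × Fin p)) :
    0 < totalDegreeHom p (degS p a) := by
  rcases a with ij | ij
  · exact (totalDegreeHom_single p (Sum.inl ij.1)).symm ▸ one_pos
  · exact (totalDegreeHom_single p (Sum.inr ij.2)).symm ▸ one_pos

lemma totalDegreeHom_degR_pos (a : Fin p × Fin p) : 0 < totalDegreeHom p (degR p a) := by
  rw [← degS_inl_add_degS_inr, map_add]
  exact add_pos (totalDegreeHom_degS_pos p _) (totalDegreeHom_degS_pos p _)

variable {k : Type*} [Field k]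

lemma multidegree_quotient {σ ι : Type*} [Fintype σ] [Fintype ι] [DecidableEq ι]
    {w : σ → (ι → ℤ)} {I : Ideal (MvPolynomial σ k)} (l : (ι → ℤ) →+ ℤ) (hl : ∀ a, 0 < l (w a))
    (hI : IsHomogeneousIdeal w I) (F : GradedFreeResolution k w (quotientGrading w I)) :
    multidegree k w (quotientGrading w I) =
      homogeneousPart (codim I).toNat (substOneSub F.laurent) := by
  rw [multidegree, Ideal.annihilator_quotient, kPolynomial_eq l hl hI F]

lemma existsUnique_isKPolynomial {σ ι : Type*} [Finite σ] {w : σ → (ι → ℤ)}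
    {I : Ideal (MvPolynomial σ k)} (l : (ι → ℤ) →+ ℤ) (hl : ∀ a, 0 < l (w a))
    (hI : IsHomogeneousIdeal w I) (F : GradedFreeResolution k w (quotientGrading w I)) :
    ∃! K, IsKPolynomial k w (quotientGrading w I) K :=
  ⟨F.laurent, ⟨F, rfl⟩, by
    rintro _ ⟨F', rfl⟩
    exact F'.laurent_eq l hl hI F⟩

/-- A graded free resolution of `R / I` gives one of `S / φ(I) S` with the same ranks and degrees. -/
lemma exists_gradedFreeResolution_standardization {p : ℕ} {I : Ideal (RingR p k)}
    (F : GradedFreeResolution k (degR p) (quotientGrading (degR p) I)) :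
    ∃ F' : GradedFreeResolution k (degS p) (quotientGrading (degS p) (standardization I)),
      F'.laurent = F.laurent := by
  let := (doubling k (Fin p × Fin p)).toRingHom.toAlgebra
  have : Module.Flat (RingR p k) (RingS p k) := doubling_flat (k := k) (σ := Fin p × Fin p)
  exact ⟨F.baseChange (isWeightedHomogeneous_doubling (degS_inl_add_degS_inr p)), rfl⟩

lemma IsCompatible.toSyn_dbl_lt {p : ℕ} {m : MonomialOrder (Fin p × Fin p)}
    {m' : MonomialOrder ((Fin p × Fin p) ⊕ (Fin p × Fin p))} (h : IsCompatible k m m')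
    (a b : (Fin p × Fin p) →₀ ℕ) (hab : m.toSyn b < m.toSyn a) :
    m'.toSyn (dbl b) < m'.toSyn (dbl a) := by
  classical
  have key : ∀ c : (Fin p × Fin p) →₀ ℕ, m'.degree (phi p k (monomial c 1)) = dbl c := by
    intro c
    have h1 : phi p k (monomial c 1) = monomial (dbl c) 1 := doubling_monomial c 1
    rw [h1, MonomialOrder.degree_monomial, if_neg one_ne_zero]
  rw [← key, ← key]
  exact h a b hab

end Standardization

end Multigraded

end

theorem mainTheorem4 (p : ℕ) (hp : 1 ≤ p) (k : Type*) [Field k]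
    (I : Ideal (Multigraded.RingR p k))
    (hI : Multigraded.IsHomogeneousIdeal (Multigraded.degR p) I)
    (J : Ideal (Multigraded.RingS p k)) (hJ : J = Multigraded.standardization I) :
    -- (i) the codimensions agree
    Multigraded.codim I = Multigraded.codim J ∧
    -- (ii) the K-polynomials are well defined and the multidegree polynomials agree
    ((∃! K, Multigraded.IsKPolynomial k (Multigraded.degR p)
        (Multigraded.quotientGrading (Multigraded.degR p) I) K) ∧
      (∃! K, Multigraded.IsKPolynomial k (Multigraded.degS p)
        (Multigraded.quotientGrading (Multigraded.degS p) J) K) ∧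
      Multigraded.multidegree k (Multigraded.degR p)
          (Multigraded.quotientGrading (Multigraded.degR p) I) =
        Multigraded.multidegree k (Multigraded.degS p)
          (Multigraded.quotientGrading (Multigraded.degS p) J)) ∧
    -- (iii) the Cohen-Macaulay property is inherited
    (Multigraded.IsCohenMacaulay (Multigraded.RingR p k ⧸ I) →
      Multigraded.IsCohenMacaulay (Multigraded.RingS p k ⧸ J)) ∧
    -- (iv) initial ideals commute with the standardization
    (∀ (m : MonomialOrder (Fin p × Fin p))
      (m' : MonomialOrder ((Fin p × Fin p) ⊕ (Fin p × Fin p))),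
      Multigraded.IsCompatible k m m' →
        Multigraded.initialIdeal m' J =
          Ideal.map (Multigraded.phi p k) (Multigraded.initialIdeal m I)) := by
  subst hJ
  have hcodim : Multigraded.codim (Multigraded.standardization I) = Multigraded.codim I :=
    Multigraded.codim_map_doubling I
  have hJ : Multigraded.IsHomogeneousIdeal (Multigraded.degS p) (Multigraded.standardization I) :=
    hI.map (Multigraded.doubling k (Fin p × Fin p)).toRingHom
      (Multigraded.isWeightedHomogeneous_doubling (Multigraded.degS_inl_add_degS_inr p))
  have hR := Multigraded.totalDegreeHom_degR_pos p
  have hS := Multigraded.totalDegreeHom_degS_pos p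
  obtain ⟨F⟩ := Multigraded.exists_gradedFreeResolution _ hR I hI
  obtain ⟨F', hF⟩ := Multigraded.exists_gradedFreeResolution_standardization F
  refine ⟨hcodim.symm, ⟨Multigraded.existsUnique_isKPolynomial _ hR hI F,
    Multigraded.existsUnique_isKPolynomial _ hS hJ F', ?_⟩,
    Multigraded.isCohenMacaulay_quotient_map_doubling I, fun m m' h =>
      Multigraded.initialIdeal_map_doubling m m' h.toSyn_dbl_lt I⟩
  -- Base change kept the K-polynomial and (i) kept the codimension, so the same homogeneous part of
  -- the same power series is taken on both sides.
  rw [Multigraded.multidegree_quotient _ hR hI F, Multigraded.multidegree_quotient _ hS hJ F', hF,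
    hcodim]
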